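/- **Setting.** Let $\xi$ be a random variable with values in $\{0,1,2,\dots\}$ and law $\pi=(\pi_i)_{i\ge0}$. Assume that $\pi$ is critical, i.e. $\sum_i i\pi_i=1$, and that it is in the domain of attraction of a stable law of index $\alpha\in(1,2]$, in the sense that $$\sum_{i=0}^n i^2\pi_i=n^{2-\alpha}L_1(n)\qquad(n\ge1),$$ where $L_1$ is slowly varying at infinity, i.e. measurable with $L_1(tx)/L_1(x)\to1$ as $x\to\infty$ for every $t>0$. Let $\mathcal T$ be the infinite random rooted plane tree with two kinds of vertices, normal and special, built as follows. The root is special. All vertices reproduce independently. A normal vertex has offspring distribution $\pi$, and all its children are normal. A special vertex has $k\ge1$ children with probability $k\pi_k$; one of these children, chosen uniformly, is special and the others are normal. For a plane tree $\tau$ in which every vertex has finitely many children, the looptree $\mathrm{Loop}(\tau)$ has the same vertices as $\tau$. Adjacent siblings are joined by an edge, and every vertex that has children is joined by one edge to its leftmost child and by one edge to its rightmost child. Thus a vertex with $k\ge1$ children gives a cycle of length $k+1$, which consists of two parallel edges if $k=1$. Let $\mathcal L=\mathrm{Loop}(\mathcal T)$, with the same root $\rho$ as $\mathcal T$. Let $B(n;\mathcal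 L)=\{x: d_{\mathcal L}(x,\rho)<n\}$, where $d_{\mathcal L}$ is the graph distance, and let $B(n;\mathcal L)^c$ be the set of the remaining vertices of $\mathcal L$. The effective resistance $R_{\mathrm{eff}}(A,B)\in[0,\infty]$ between disjoint vertex sets $A,B$ of a graph with edge set $E$ is given by $$R_{\mathrm{eff}}(A,B)^{-1}=\inf\Big\{\sum_{xy\in E}(h(x)-h(y))^2 : h \text{ real-valued},\ h=1\text{ on }A,\ h=0\text{ on }B\Big\}.$$ **Lemma.** For every $q\in(0,\alpha-1)$ there is a constant $c>0$ (depending only on $\pi$, $\alpha$ and $q$) such that for all integers $n\ge1$ and all real $\lambda>0$, $$\mathbb P\big(R_{\mathrm{eff}}(\rho,B(n;\mathcal L)^c)<\lambda^{-1}n\big)\le c\,\lambda^{-q}.$$ -/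

import Mathlib

open MeasureTheory Filter Topology
open scoped ENNReal Graph

noncomputable section

/-- `L` varies slowly at infinity. -/
def IsSlowlyVarying (L : ℝ → ℝ) : Prop :=
  Measurable L ∧ ∀ t : ℝ, 0 < t → Tendsto (fun x => L (t * x) / L x) atTop (𝓝 1)

/-- The offspring distribution `π` has mean one. -/
def IsCritical (π : PMF ℕ) : Prop := ∑' k : ℕ, (k : ℝ≥0∞) * π k = 1

/-- `π` is in the domain of attraction of a stable law of index `α`: its truncated second moment
`∑_{i ≤ n} i ^ 2 π_i` equals `n ^ (2 - α) L₁(n)` with `L₁` slowly varying at infinity. -/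
def InStableDomain (π : PMF ℕ) (α : ℝ) : Prop :=
  ∃ L₁ : ℝ → ℝ, IsSlowlyVarying L₁ ∧ ∀ n : ℕ, 1 ≤ n →
    ∑ i ∈ Finset.range (n + 1), (i : ℝ) ^ 2 * (π i).toReal = (n : ℝ) ^ (2 - α) * L₁ n

/-! ### Plane trees -/

/-- A locally finite rooted plane tree, in the usual word encoding: the root is the empty word and
the children of `v`, from left to right, are `v ++ [0], …, v ++ [out v - 1]`.
(`out` is only meaningful at the vertices of the tree.) -/
structure PlaneTree where
  verts : Set (List ℕ)
  out : List ℕ → ℕ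
  nil_mem : [] ∈ verts
  parent_mem : ∀ v i, v ++ [i] ∈ verts → v ∈ verts
  child_mem_iff : ∀ v ∈ verts, ∀ i, v ++ [i] ∈ verts ↔ i < out v

/-- The plane tree in which the vertex `v` has `d v` children. -/
def PlaneTree.ofOut (d : List ℕ → ℕ) : PlaneTree where
  verts := {u | ∀ v i, (v ++ [i]) <+: u → i < d v}
  out := d
  nil_mem := by
    intro v i h
    simp at h
  parent_mem := fun v i h w j hw => h w j (hw.trans (List.prefix_append _ _))
  child_mem_iff := by
    intro v hv i
    refine ⟨fun h => h v i List.prefix_rfl, fun hi w j hw => ?_⟩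
    rcases List.prefix_concat_iff.mp hw with h | h
    · obtain ⟨rfl, hj⟩ := List.append_inj' h rfl
      simp only [List.cons.injEq, and_true] at hj
      exact hj ▸ hi
    · exact hv w j h

/-! ### Looptrees -/

/-- Names for the edges of a looptree: between the siblings `v ++ [i]` and `v ++ [i + 1]`, from `v`
to its leftmost child, and from `v` to its rightmost child. -/
inductive LoopEdge where
  | sibling (v : List ℕ) (i : ℕ)
  | leftmost (v : List ℕ)
  | rightmost (v : List ℕ)

/-- The edges that are present in the looptree of `T`. -/
def PlaneTree.HasLoopEdge (T : PlaneTree) : LoopEdge → Prop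
  | .sibling v i => v ∈ T.verts ∧ i + 1 < T.out v
  | .leftmost v => v ∈ T.verts ∧ 0 < T.out v
  | .rightmost v => v ∈ T.verts ∧ 0 < T.out v

/-- The two ends of an edge of the looptree of `T`. -/
def PlaneTree.loopEnds (T : PlaneTree) : LoopEdge → Sym2 (List ℕ)
  | .sibling v i => s(v ++ [i], v ++ [i + 1])
  | .leftmost v => s(v, v ++ [0])
  | .rightmost v => s(v, v ++ [T.out v - 1])

lemma PlaneTree.mem_verts_of_mem_loopEnds (T : PlaneTree) {e : LoopEdge} (he : T.HasLoopEdge e)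
    {x : List ℕ} (hx : x ∈ T.loopEnds e) : x ∈ T.verts := by
  cases e with
  | sibling v i =>
    obtain ⟨hv, hi⟩ := he
    rcases Sym2.mem_iff.mp hx with rfl | rfl
    · exact (T.child_mem_iff v hv i).2 (by omega)
    · exact (T.child_mem_iff v hv (i + 1)).2 hi
  | leftmost v =>
    obtain ⟨hv, hi⟩ := he
    rcases Sym2.mem_iff.mp hx with rfl | rfl
    · exact hv
    · exact (T.child_mem_iff v hv 0).2 hi
  | rightmost v =>
    obtain ⟨hv, hi⟩ := he
    rcases Sym2.mem_iff.mp hx with rfl | rfl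
    · exact hv
    · exact (T.child_mem_iff v hv _).2 (by omega)

/-- The looptree of `T`: same vertices, adjacent siblings are joined by an edge, and every vertex
that has children is joined by one edge to its leftmost and by one edge to its rightmost child.
A vertex with `k ≥ 1` children gives a cycle of length `k + 1`
(two parallel edges if `k = 1`). -/
def PlaneTree.loop (T : PlaneTree) : Graph (List ℕ) LoopEdge where
  vertexSet := T.verts
  IsLink e x y := T.HasLoopEdge e ∧ T.loopEnds e = s(x, y)
  isLink_symm := fun _ _ => ⟨fun _ _ h => ⟨h.1, h.2.trans Sym2.eq_swap⟩⟩
  eq_or_eq_of_isLink_of_isLink := by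
    rintro e x y v w ⟨-, h⟩ ⟨-, h'⟩
    rcases Sym2.eq_iff.mp (h.symm.trans h') with h | h
    · exact Or.inl h.1
    · exact Or.inr h.1
  left_mem_of_isLink := by
    rintro e x y ⟨he, h⟩
    exact T.mem_verts_of_mem_loopEnds he (h ▸ Sym2.mem_mk_left x y)

/-- The root of the looptree of `T`. -/
def PlaneTree.loopRoot (T : PlaneTree) : V(T.loop) := ⟨[], T.nil_mem⟩

/-! ### Graph balls and effective resistance -/

section Resistance

variable {β ε : Type*}

/-- The open graph ball `B(n; G)` around `x`: the vertices at graph distance less than `n`. -/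
def graphBall (G : Graph β ε) (x : V(G)) (n : ℕ) : Set V(G) :=
  G.toSimpleGraph.ball x n

/-- One end of the edge `e`. -/
def edgeFst (G : Graph β ε) (e : E(G)) : V(G) :=
  ⟨(G.exists_isLink_of_mem_edgeSet e.2).choose,
    (G.exists_isLink_of_mem_edgeSet e.2).choose_spec.choose_spec.left_mem⟩

/-- The other end of the edge `e`. -/
def edgeSnd (G : Graph β ε) (e : E(G)) : V(G) :=
  ⟨(G.exists_isLink_of_mem_edgeSet e.2).choose_spec.choose,
    (G.exists_isLink_of_mem_edgeSet e.2).choose_spec.choose_spec.right_mem⟩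

/-- The energy `∑_{xy ∈ E} (h x - h y) ^ 2`. -/
def dirichletEnergy (G : Graph β ε) (h : V(G) → ℝ) : ℝ≥0∞ :=
  ∑' e : E(G), ENNReal.ofReal ((h (edgeFst G e) - h (edgeSnd G e)) ^ 2)

/-- The effective resistance between `A` and `B`: the inverse of the infimum of the energies of the
functions that are `1` on `A` and `0` on `B` (it is `∞` if the infimum is `0`). -/
def effectiveResistance (G : Graph β ε) (A B : Set V(G)) : ℝ≥0∞ :=
  (⨅ (h : V(G) → ℝ) (_ : (∀ a ∈ A, h a = 1) ∧ ∀ b ∈ B, h b = 0), dirichletEnergy G h)⁻¹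

end Resistance

/-! ### The infinite random tree with a spine, and its looptree -/

/-- The size-biased distribution `k ↦ k π_k` of a critical offspring distribution. -/
def sizeBiased (π : PMF ℕ) (hπ : IsCritical π) : PMF ℕ :=
  ⟨fun k => (k : ℝ≥0∞) * π k, (ENNReal.summable.hasSum_iff).2 hπ⟩

/-- The law of the number `k` of children of a special vertex (size-biased), together with the
index `j`, uniform in `{0, …, k - 1}`, of its special child.
(The value at `k = 0` has probability zero.) -/
def specialOffspring (π : PMF ℕ) (hπ : IsCritical π) : PMF (ℕ × ℕ) :=
  (sizeBiased π hπ).bind fun k =>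
    if hk : k ≠ 0 then
      (PMF.uniformOfFinset (Finset.range k) (Finset.nonempty_range_iff.2 hk)).map fun j => (k, j)
    else PMF.pure (0, 0)

/-- The data from which the random tree is built: for every word the number of its children in case
it is a normal vertex, and for every generation the number of children of the special vertex in
this generation and the index of its special child. -/
abbrev SpineData : Type := (List ℕ → ℕ) × (ℕ → ℕ × ℕ)

/-- All the data are independent, with law `π` at normal vertices and `specialOffspring` at
special vertices. -/
def spineMeasure (π : PMF ℕ) (hπ : IsCritical π) : Measure SpineData :=
  (Measure.infinitePi fun _ : List ℕ => π.toMeasure).prod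
    (Measure.infinitePi fun _ : ℕ => (specialOffspring π hπ).toMeasure)

/-- The special vertex in generation `k`: the root is special, and every special vertex has exactly
one special child. -/
def spineVertex (ω : SpineData) : ℕ → List ℕ
  | 0 => []
  | k + 1 => spineVertex ω k ++ [(ω.2 k).2]

open scoped Classical in
/-- The modified Galton--Watson tree with one infinite spine. -/
def spineTree (ω : SpineData) : PlaneTree :=
  PlaneTree.ofOut fun v =>
    if v = spineVertex ω v.length then (ω.2 v.length).1 else ω.1 v

/-- The infinite random looptree. -/
def randomLooptree (ω : SpineData) : Graph (List ℕ) LoopEdge := (spineTree ω).loop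

/-- The root of the infinite random looptree. -/
def looptreeRoot (ω : SpineData) : V(randomLooptree ω) := (spineTree ω).loopRoot

end

/-!
The bound holds with `t⁻¹` in place of `t ^ (-q)`, for every critical offspring law: the mean of the
effective conductance between the root and the complement of the ball of radius `n` is `O(1 / n)`,
and Markov's inequality applies. Since `α ≤ 2`, the exponent `q` is less than one.

*Deterministic part.* Let `D` be the sum of the distances covered in the successive loops on the way
from the root to a vertex (`loopDepth`); it dominates the graph distance. For a vertex `w`, the
potential that grows like `D` along the path of loops to `w`, on both sides of each loop, and is
constant elsewhere (`pathPotential`), has energy at most `2 D(w)`, because each loop contributes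
twice its shorter side. Hence a vertex at depth at least `m` is cut off at the cost `2 / m`, and the
minimum of such test functions shows that the conductance is at most `2 / m` times the size of a
cutset (`exists_testFunction`, `inv_le_effectiveResistance`). With `m = ⌈n / 3⌉` the cutset
`cutList` is made of the vertices where `D` first reaches `m`, without reaching `2 m`, and from
which a further depth `n - 2 m` is reached, and of the loops with at least `2 m` children at a
vertex of depth less than `m`.

*Mean size of the cutset.* Write `Q = ∑ k π_k min(k, m)`, and `M` for the mean of the depth
increment along the spine, truncated at `m`; then `Q ≤ 6 M` (`meanChildren_le`). A renewal argument
(`meanStep_mul_le`) shows that the spine has `O(m / M)` vertices of depth less than `m` in the mean,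
and that so has a normal tree. The attached normal trees with a root at distance less than `2 m` in
the loop of a special vertex number `O(Q)` in the mean, so there are `O(m)` of them in total. Each
one contains `O(1 / m)` points of the cutset in the mean, for two reasons: it reaches a depth of
order `m` with probability `O(1 / m)` (`exists_reachProb_le`), and the large loops contribute
`O(m / M) P(ξ ≥ 2 m)`, where `m ^ 2 P(ξ ≥ 2 m) ≤ Q`. Finally, the large loops of the spine number
`O(m / M) (Q / m) = O(1)`. So the mean size of the cutset is bounded (`exists_spineMean_le`). All
slowly varying factors are absorbed in the ratio of `Q` and `M`. If `π_1 = 1`, a normal tree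
is an infinite ray, but none is attached to the spine.

The probability of reaching depth `r` is estimated by induction on `r`, through the branching
property (`measurePreserving_graft`): for a root with `k ≥ 2` children, the second-order term in
`1 - (1 - x) ^ k` outweighs the depth that is lost in the first loop (`one_sub_prod_le`).
-/

noncomputable section

/-! ### Distances along the tree -/

/-- The distance, in a cycle formed by a vertex and its `k` children, from the vertex to its child
of index `i < k`. -/
def loopStep (k i : ℕ) : ℕ := min (i + 1) (k - i)

/-- The offspring numbers of the subtree rooted at the child of index `i` of the root. -/
def subtreeAt (d : List ℕ → ℕ) (i : ℕ) : List ℕ → ℕ := fun v => d (i :: v)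

/-- The sum of the distances covered in the successive loops between the root and `v`. -/
def loopDepth : (List ℕ → ℕ) → List ℕ → ℕ
  | _, [] => 0
  | d, i :: v => loopStep (d []) i + loopDepth (subtreeAt d i) v

lemma loopDepth_append_singleton (d : List ℕ → ℕ) (v : List ℕ) (i : ℕ) :
    loopDepth d (v ++ [i]) = loopDepth d v + loopStep (d v) i := by
  induction v generalizing d with
  | nil => simp [loopDepth]
  | cons j v ih =>
    simp only [List.cons_append, loopDepth, ih]
    simp only [subtreeAt]
    omega

lemma cons_mem_verts_ofOut {d : List ℕ → ℕ} {i : ℕ} {v : List ℕ} :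
    i :: v ∈ (PlaneTree.ofOut d).verts ↔
      i < d [] ∧ v ∈ (PlaneTree.ofOut (subtreeAt d i)).verts := by
  constructor
  · intro h
    refine ⟨h [] i (by simp), fun w j hw => h (i :: w) j (by simpa using hw)⟩
  · rintro ⟨hi, hv⟩ w j hw
    cases w with
    | nil =>
      simp only [List.nil_append, List.cons_prefix_cons, List.nil_prefix, and_true] at hw
      exact hw ▸ hi
    | cons a w =>
      simp only [List.cons_append, List.cons_prefix_cons] at hw
      obtain ⟨rfl, hw⟩ := hw
      exact hv w j hw

lemma edist_loop_le_one (T : PlaneTree) {x y : V(T.loop)} (e : LoopEdge) (he : T.HasLoopEdge e)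
    (hxy : T.loopEnds e = s(x.1, y.1)) : T.loop.toSimpleGraph.edist x y ≤ 1 := by
  rw [SimpleGraph.edist_le_one_iff_adj_or_eq]
  by_cases h : x = y
  · exact Or.inr h
  · exact Or.inl ⟨h, e, he, hxy⟩

lemma edist_child_le (T : PlaneTree) {v : List ℕ} (hv : v ∈ T.verts) {i : ℕ} (hi : i < T.out v) :
    T.loop.toSimpleGraph.edist ⟨v ++ [i], (T.child_mem_iff v hv i).2 hi⟩ ⟨v, hv⟩ ≤
      (loopStep (T.out v) i : ℕ) := by
  have hleft : ∀ i (hi : i < T.out v),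
      T.loop.toSimpleGraph.edist ⟨v ++ [i], (T.child_mem_iff v hv i).2 hi⟩ ⟨v, hv⟩ ≤
        ((i + 1 : ℕ) : ℕ∞) := by
    intro i
    induction i with
    | zero =>
      intro hi
      refine (edist_loop_le_one T (.leftmost v) ⟨hv, hi⟩ ?_).trans (by simp)
      exact Sym2.eq_swap
    | succ i ih =>
      intro hi
      refine (SimpleGraph.edist_triangle (v := ⟨v ++ [i], (T.child_mem_iff v hv i).2
        (by omega)⟩)).trans ?_
      rw [Nat.cast_add, add_comm, Nat.cast_one]
      exact add_le_add (ih (by omega)) (edist_loop_le_one T (.sibling v i) ⟨hv, hi⟩ Sym2.eq_swap)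
  have hright : ∀ l i (hi : i < T.out v), T.out v - i = l + 1 →
      T.loop.toSimpleGraph.edist ⟨v ++ [i], (T.child_mem_iff v hv i).2 hi⟩ ⟨v, hv⟩ ≤
        ((l + 1 : ℕ) : ℕ∞) := by
    intro l
    induction l with
    | zero =>
      intro i hi hl
      have : T.out v - 1 = i := by omega
      refine (edist_loop_le_one T (.rightmost v) ⟨hv, by omega⟩ ?_).trans (by simp)
      simp only [PlaneTree.loopEnds, this]
      exact Sym2.eq_swap
    | succ l ih =>
      intro i hi hl
      refine (SimpleGraph.edist_triangle (v := ⟨v ++ [i + 1], (T.child_mem_iff v hv (i + 1)).2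
        (by omega)⟩)).trans ?_
      rw [Nat.cast_add, add_comm, Nat.cast_one]
      exact add_le_add (ih _ (by omega) (by omega))
        (edist_loop_le_one T (.sibling v i) ⟨hv, by omega⟩ rfl)
  obtain ⟨l, hl⟩ : ∃ l, T.out v - i = l + 1 := ⟨T.out v - i - 1, by omega⟩
  rw [loopStep]
  rcases min_choice (i + 1) (T.out v - i) with h | h <;> rw [h]
  · exact hleft i hi
  · rw [hl]; exact hright l i hi hl

/-- Only this half of the equality of the graph distance and the loop depth is needed. -/
lemma edist_root_le_loopDepth (d : List ℕ → ℕ) (v : List ℕ)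
    (hv : v ∈ (PlaneTree.ofOut d).verts) :
    (PlaneTree.ofOut d).loop.toSimpleGraph.edist ⟨v, hv⟩ (PlaneTree.ofOut d).loopRoot ≤
      (loopDepth d v : ℕ) := by
  induction v using List.reverseRecOn with
  | nil => exact (SimpleGraph.edist_self).le.trans (by simp)
  | append_singleton v i ih =>
    have hv' := (PlaneTree.ofOut d).parent_mem v i hv
    refine (SimpleGraph.edist_triangle (v := ⟨v, hv'⟩)).trans ?_
    rw [loopDepth_append_singleton, add_comm (loopDepth d v), Nat.cast_add]
    exact add_le_add (edist_child_le (PlaneTree.ofOut d) hv'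
      (((PlaneTree.ofOut d).child_mem_iff v hv' i).1 hv)) (ih hv')

/-! ### Energies of functions on a looptree -/

/-- The values of `h` along the cycle formed by `v` and its `k` children, read from `v` back to
`v`, with positions `0, …, k + 1`. -/
def loopVal (h : List ℕ → ℝ) (k : ℕ) (v : List ℕ) (s : ℕ) : ℝ :=
  if s = 0 ∨ s = k + 1 then h v else h (v ++ [s - 1])

/-- The energy of `h` in the cycle formed by `v` and its `k` children. For `k = 0` it vanishes. -/
def cycleEnergy (h : List ℕ → ℝ) (k : ℕ) (v : List ℕ) : ℝ≥0∞ :=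
  ∑ s ∈ Finset.range (k + 1), ENNReal.ofReal ((loopVal h k v (s + 1) - loopVal h k v s) ^ 2)

/-- The energy of `h` in the looptree of the tree with offspring numbers `d`, summed cycle by cycle
over all words. -/
def loopEnergy (d : List ℕ → ℕ) (h : List ℕ → ℝ) : ℝ≥0∞ := ∑' v, cycleEnergy h (d v) v

/-- The cycle of an edge of a looptree, and its position in this cycle. -/
def edgePos (d : List ℕ → ℕ) : LoopEdge → List ℕ × ℕ
  | .leftmost v => (v, 0)
  | .sibling v i => (v, i + 1)
  | .rightmost v => (v, d v)

lemma sq_edge_sub (G : Graph (List ℕ) LoopEdge) (h : List ℕ → ℝ) (e : E(G)) {x y : List ℕ}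
    (hxy : G.IsLink e x y) :
    (h (edgeFst G e).1 - h (edgeSnd G e).1) ^ 2 = (h x - h y) ^ 2 := by
  have hl : G.IsLink e (edgeFst G e).1 (edgeSnd G e).1 :=
    (G.exists_isLink_of_mem_edgeSet e.2).choose_spec.choose_spec
  rcases hl.eq_and_eq_or_eq_and_eq hxy with ⟨h1, h2⟩ | ⟨h1, h2⟩ <;> rw [h1, h2]
  ring

lemma hasLoopEdge_of_mem_edgeSet {T : PlaneTree} (e : E(T.loop)) : T.HasLoopEdge e.1 := by
  obtain ⟨x, y, h⟩ := T.loop.exists_isLink_of_mem_edgeSet e.2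
  exact h.1

lemma dirichletEnergy_le_loopEnergy (d : List ℕ → ℕ) (h : List ℕ → ℝ) :
    dirichletEnergy (PlaneTree.ofOut d).loop (fun x => h x.1) ≤ loopEnergy d h := by
  set T := PlaneTree.ofOut d with hT
  have hout : T.out = d := rfl
  let H : List ℕ × ℕ → ℝ≥0∞ := fun p => if p.2 < d p.1 + 1 then
    ENNReal.ofReal ((loopVal h (d p.1) p.1 (p.2 + 1) - loopVal h (d p.1) p.1 p.2) ^ 2) else 0
  have hH : loopEnergy d h = ∑' p, H p := by
    rw [ENNReal.tsum_prod', loopEnergy]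
    refine tsum_congr fun v => ?_
    rw [tsum_eq_sum (s := Finset.range (d v + 1))
      (fun s hs => if_neg (by simpa using hs)), cycleEnergy]
    exact Finset.sum_congr rfl fun s hs => (if_pos (Finset.mem_range.1 hs)).symm
  have hinj : Function.Injective fun e : E(T.loop) => edgePos d e.1 := by
    rintro ⟨e, he⟩ ⟨e', he'⟩ hee
    have h1 := hasLoopEdge_of_mem_edgeSet ⟨e, he⟩
    have h2 := hasLoopEdge_of_mem_edgeSet ⟨e', he'⟩
    cases e <;> cases e' <;>
      simp only [PlaneTree.HasLoopEdge, edgePos, Prod.mk.injEq, Subtype.mk.injEq,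
        LoopEdge.sibling.injEq, LoopEdge.leftmost.injEq, LoopEdge.rightmost.injEq,
        hout] at h1 h2 hee ⊢ <;> obtain ⟨rfl, hee⟩ := hee <;> first | omega | simp_all
  rw [hH]
  refine le_trans ?_ (ENNReal.tsum_comp_le_tsum_of_injective hinj H)
  refine ENNReal.tsum_le_tsum fun e => ?_
  have hend : ∀ {x y : List ℕ}, T.loopEnds e.1 = s(x, y) →
      (h (edgeFst T.loop e).1 - h (edgeSnd T.loop e).1) ^ 2 = (h x - h y) ^ 2 :=
    fun hxy => sq_edge_sub T.loop h e ⟨hasLoopEdge_of_mem_edgeSet e, hxy⟩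
  have h1 := hasLoopEdge_of_mem_edgeSet e
  obtain ⟨e, he⟩ := e
  cases e with
  | sibling v i =>
    have hi : i + 1 < d v := h1.2
    rw [hend (x := v ++ [i + 1]) (y := v ++ [i]) Sym2.eq_swap]
    have e1 : i < d v := by omega
    have e2 : i + 1 ≠ d v := by omega
    have e3 : i ≠ d v := by omega
    simp [H, edgePos, loopVal, e1, e2, e3]
  | leftmost v =>
    have hi : 0 < d v := h1.2
    rw [hend (x := v ++ [0]) (y := v) Sym2.eq_swap]
    simp [H, edgePos, loopVal, hi.ne]
  | rightmost v =>
    have hi : 0 < d v := h1.2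
    rw [hend (x := v) (y := v ++ [d v - 1]) rfl]
    simp [H, edgePos, loopVal, hi.ne']

lemma loopEnergy_const (d : List ℕ → ℕ) (a : ℝ) : loopEnergy d (fun _ => a) = 0 := by
  simp [loopEnergy, cycleEnergy, loopVal]

lemma loopEnergy_one_sub_div (d : List ℕ → ℕ) (g : List ℕ → ℝ) (a : ℝ) :
    loopEnergy d (fun x => 1 - g x / a) = ENNReal.ofReal ((a ^ 2)⁻¹) * loopEnergy d g := by
  simp only [loopEnergy, cycleEnergy, ← ENNReal.tsum_mul_left, Finset.mul_sum]
  refine tsum_congr fun v => Finset.sum_congr rfl fun s _ => ?_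
  rw [← ENNReal.ofReal_mul (by positivity)]
  congr 1
  have : ∀ s, loopVal (fun x => 1 - g x / a) (d v) v s = 1 - loopVal g (d v) v s / a := by
    intro s; simp only [loopVal]; split_ifs <;> rfl
  rw [this, this]
  ring

lemma loopEnergy_min_le (d : List ℕ → ℕ) (f g : List ℕ → ℝ) :
    loopEnergy d (fun x => min (f x) (g x)) ≤ loopEnergy d f + loopEnergy d g := by
  simp only [loopEnergy, cycleEnergy]
  rw [← ENNReal.tsum_add]
  refine ENNReal.tsum_le_tsum fun v => ?_
  rw [← Finset.sum_add_distrib]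
  refine Finset.sum_le_sum fun s _ => ?_
  rw [← ENNReal.ofReal_add (sq_nonneg _) (sq_nonneg _)]
  refine ENNReal.ofReal_le_ofReal ?_
  have : ∀ s, loopVal (fun x => min (f x) (g x)) (d v) v s =
      min (loopVal f (d v) v s) (loopVal g (d v) v s) := by
    intro s; simp only [loopVal]; split_ifs <;> rfl
  rw [this, this]
  have key : ∀ a b c e : ℝ, (min a b - min c e) ^ 2 ≤ (a - c) ^ 2 + (b - e) ^ 2 := by
    intro a b c e
    have h := abs_min_sub_min_le_max a b c e
    rw [← sq_abs (min a b - min c e), ← sq_abs (a - c), ← sq_abs (b - e)]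
    have h0 := abs_nonneg (min a b - min c e)
    rcases le_max_iff.1 h with h | h <;>
      nlinarith [abs_nonneg (a - c), abs_nonneg (b - e), sq_nonneg |a - c|, sq_nonneg |b - e|]
  exact key _ _ _ _

/-! ### Potentials -/

/-- The potential that grows with unit speed along the path of loops from the root to `w`, on both
sides of each loop, and then up to height `c` in the loop formed by `w` and its children. It is
constant on everything that hangs off this path. -/
def pathPotential (c : ℕ) : (List ℕ → ℕ) → List ℕ → List ℕ → ℕ
  | _, _, [] => 0
  | d, [], i :: _ => min (loopStep (d []) i) c
  | d, j :: w, i :: y =>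
    if i = j then loopStep (d []) j + pathPotential c (subtreeAt d j) w y
    else min (loopStep (d []) i) (loopStep (d []) j)

@[simp] lemma pathPotential_root (c : ℕ) (d : List ℕ → ℕ) (w : List ℕ) :
    pathPotential c d w [] = 0 := by
  cases w <;> rfl

lemma pathPotential_le (c : ℕ) (d : List ℕ → ℕ) (w y : List ℕ) :
    pathPotential c d w y ≤ loopDepth d w + c := by
  induction w generalizing d y with
  | nil => cases y <;> simp [pathPotential, loopDepth]
  | cons j w ih =>
    cases y with
    | nil => simp
    | cons i y =>
      have := ih (subtreeAt d j) y
      simp only [pathPotential, loopDepth]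
      split_ifs <;> omega

/-- Along a cycle, a potential that is a truncation at height `c` of the distance to the starting
point varies by one on at most `2 c` edges. -/
lemma cycleEnergy_truncation_le (h : List ℕ → ℝ) (k c : ℕ) (v : List ℕ) (b : ℝ) (h0 : h v = b)
    (hs : ∀ i < k, h (v ++ [i]) = b + (min (loopStep k i) c : ℕ)) :
    cycleEnergy h k v ≤ 2 * c := by
  have hval : ∀ s ≤ k + 1, loopVal h k v s = b + (min (min s (k + 1 - s)) c : ℕ) := by
    intro s hsk
    simp only [loopVal]
    split_ifs with hc
    · have : min (min s (k + 1 - s)) c = 0 := by omega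
      simp [this, h0]
    · rw [hs _ (by omega), loopStep]
      congr 3
      omega
  have hterm : ∀ s ∈ Finset.range (k + 1),
      ENNReal.ofReal ((loopVal h k v (s + 1) - loopVal h k v s) ^ 2) ≤
        (if s < c then 1 else 0) + (if k + 1 - c ≤ s then 1 else 0) := by
    intro s hsk
    rw [Finset.mem_range] at hsk
    rw [hval s (by omega), hval (s + 1) (by omega)]
    by_cases hs1 : s < c ∨ k + 1 - c ≤ s
    · have : (1 : ℝ≥0∞) ≤ (if s < c then 1 else 0) + (if k + 1 - c ≤ s then 1 else 0) := by
        rcases hs1 with h | h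
        · rw [if_pos h]; exact le_self_add
        · rw [if_pos h]; exact le_add_self
      refine le_trans ?_ this
      rw [← ENNReal.ofReal_one]
      refine ENNReal.ofReal_le_ofReal ?_
      have e1 : min (min (s + 1) (k + 1 - (s + 1))) c ≤ min (min s (k + 1 - s)) c + 1 := by omega
      have e2 : min (min s (k + 1 - s)) c ≤ min (min (s + 1) (k + 1 - (s + 1))) c + 1 := by omega
      have e1' : ((min (min (s + 1) (k + 1 - (s + 1))) c : ℕ) : ℝ) ≤
        ((min (min s (k + 1 - s)) c : ℕ) : ℝ) + 1 := by exact_mod_cast e1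
      have e2' : ((min (min s (k + 1 - s)) c : ℕ) : ℝ) ≤
        ((min (min (s + 1) (k + 1 - (s + 1))) c : ℕ) : ℝ) + 1 := by exact_mod_cast e2
      nlinarith
    · have : min (min (s + 1) (k + 1 - (s + 1))) c = min (min s (k + 1 - s)) c := by omega
      rw [this]
      simp
  refine (Finset.sum_le_sum hterm).trans ?_
  rw [Finset.sum_add_distrib, Finset.sum_boole, Finset.sum_boole, two_mul]
  gcongr
  · calc _ ≤ (Finset.range c).card := Finset.card_le_card fun s hs => by
          simp only [Finset.mem_filter, Finset.mem_range] at hs ⊢; omega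
      _ = c := Finset.card_range c
  · calc _ ≤ (Finset.Ico (k + 1 - c) (k + 1)).card := Finset.card_le_card fun s hs => by
          simp only [Finset.mem_filter, Finset.mem_range, Finset.mem_Ico] at hs ⊢; omega
      _ ≤ c := by rw [Nat.card_Ico]; omega

lemma cycleEnergy_eq_zero (h : List ℕ → ℝ) (k : ℕ) (v : List ℕ) (b : ℝ) (h0 : h v = b)
    (hs : ∀ i, h (v ++ [i]) = b) : cycleEnergy h k v = 0 := by
  simp [cycleEnergy, loopVal, h0, hs]

lemma cycleEnergy_congr_add (h g : List ℕ → ℝ) (k : ℕ) (v u : List ℕ) (b : ℝ)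
    (h0 : h v = b + g u) (hs : ∀ i, h (v ++ [i]) = b + g (u ++ [i])) :
    cycleEnergy h k v = cycleEnergy g k u := by
  have : ∀ s, loopVal h k v s = b + loopVal g k u s := by
    intro s; simp only [loopVal]; split_ifs
    · exact h0
    · exact hs _
  simp [cycleEnergy, this]

/-- A sum over all words, split according to the first letter. -/
lemma tsum_list_eq (f : List ℕ → ℝ≥0∞) : ∑' v, f v = f [] + ∑' i, ∑' v, f (i :: v) := by
  let e : Unit ⊕ (ℕ × List ℕ) ≃ List ℕ :=
    { toFun := Sum.elim (fun _ => []) fun p => p.1 :: p.2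
      invFun := fun l => match l with
        | [] => .inl ()
        | i :: v => .inr (i, v)
      left_inv := by rintro (_ | ⟨i, v⟩) <;> rfl
      right_inv := by rintro (_ | ⟨i, v⟩) <;> rfl }
  rw [← e.tsum_eq, ENNReal.summable.tsum_sum ENNReal.summable, tsum_fintype,
    ENNReal.tsum_prod']
  simp [e]

/-- The energy of a path potential is at most twice its maximum. -/
lemma loopEnergy_pathPotential_le (c : ℕ) (d : List ℕ → ℕ) (w : List ℕ) :
    loopEnergy d (fun y => (pathPotential c d w y : ℝ)) ≤ 2 * ((loopDepth d w + c : ℕ) : ℝ≥0∞) := by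
  induction w generalizing d with
  | nil =>
    rw [loopEnergy, tsum_list_eq]
    have : ∀ i v, cycleEnergy (fun y => (pathPotential c d [] y : ℝ)) (d (i :: v)) (i :: v) = 0 :=
      fun i v => cycleEnergy_eq_zero _ _ _ _ rfl fun _ => rfl
    simp only [this, tsum_zero, add_zero, loopDepth, zero_add]
    exact cycleEnergy_truncation_le _ _ _ _ 0 (by simp) fun i _ => by simp [pathPotential]
  | cons j w ih =>
    rw [loopEnergy, tsum_list_eq]
    have hne : ∀ i ≠ j, ∑' v, cycleEnergy (fun y => (pathPotential c d (j :: w) y : ℝ))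
        (d (i :: v)) (i :: v) = 0 := by
      intro i hij
      refine ENNReal.tsum_eq_zero.2 fun v => cycleEnergy_eq_zero _ _ _
        (min (loopStep (d []) i) (loopStep (d []) j) : ℕ) ?_ fun l => ?_ <;>
        simp [pathPotential, hij]
    have hj : ∑' v, cycleEnergy (fun y => (pathPotential c d (j :: w) y : ℝ))
        (d (j :: v)) (j :: v) ≤ 2 * ((loopDepth (subtreeAt d j) w + c : ℕ) : ℝ≥0∞) := by
      refine le_trans (le_of_eq (tsum_congr fun v => ?_)) (ih (subtreeAt d j))
      refine cycleEnergy_congr_add _ _ _ _ _ (loopStep (d []) j) ?_ fun l => ?_ <;>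
        simp [pathPotential]
    rw [tsum_eq_single j hne]
    have h0 : cycleEnergy (fun y => (pathPotential c d (j :: w) y : ℝ)) (d []) [] ≤
        2 * (loopStep (d []) j : ℕ) := by
      refine cycleEnergy_truncation_le _ _ _ _ 0 (by simp) fun i _ => ?_
      by_cases hij : i = j <;> simp [pathPotential, hij]
    refine (add_le_add h0 hj).trans ?_
    rw [← mul_add, loopDepth, ← Nat.cast_add, add_assoc]

/-- Finitely many path potentials of height at least `m` give one test function, which vanishes
wherever one of the potentials is maximal. -/
lemma exists_testFunction (d : List ℕ → ℕ) {m : ℕ} (hm : 0 < m) (l : List (List ℕ × ℕ))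
    (hl : ∀ p ∈ l, m ≤ loopDepth d p.1 + p.2) :
    ∃ h : List ℕ → ℝ, h [] = 1 ∧ (∀ y, 0 ≤ h y) ∧
      (∀ y, (∃ p ∈ l, loopDepth d p.1 + p.2 ≤ pathPotential p.2 d p.1 y) → h y = 0) ∧
      loopEnergy d h ≤ l.length * ENNReal.ofReal (2 / m) := by
  induction l with
  | nil => exact ⟨fun _ => 1, rfl, fun _ => zero_le_one, by simp, by simp [loopEnergy_const]⟩
  | cons p l ih =>
    obtain ⟨h, h1, h2, h3, h4⟩ := ih fun q hq => hl q (List.mem_cons_of_mem _ hq)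
    have hp := hl p List.mem_cons_self
    set M := loopDepth d p.1 + p.2 with hM
    have hM0 : 0 < M := by omega
    have hMR : (0 : ℝ) < M := by exact_mod_cast hM0
    have hnn : ∀ y, (0 : ℝ) ≤ 1 - (pathPotential p.2 d p.1 y : ℝ) / M := by
      intro y
      rw [sub_nonneg, div_le_one hMR]
      exact_mod_cast pathPotential_le _ _ _ _
    refine ⟨fun y => min (1 - (pathPotential p.2 d p.1 y : ℝ) / M) (h y), by simp [h1],
      fun y => le_min (hnn y) (h2 y), ?_, ?_⟩
    · rintro y ⟨q, hq, hqy⟩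
      refine le_antisymm ?_ (le_min (hnn y) (h2 y))
      rcases List.mem_cons.1 hq with rfl | hq
      · refine (min_le_left _ _).trans ?_
        rw [sub_nonpos, one_le_div hMR]
        exact_mod_cast hqy
      · exact (min_le_right _ _).trans (h3 y ⟨q, hq, hqy⟩).le
    · refine (loopEnergy_min_le d _ _).trans ?_
      rw [List.length_cons, Nat.cast_succ, add_mul, one_mul, add_comm]
      refine add_le_add h4 ?_
      rw [loopEnergy_one_sub_div]
      calc ENNReal.ofReal (((M : ℝ) ^ 2)⁻¹) *
            loopEnergy d (fun y => (pathPotential p.2 d p.1 y : ℝ))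
          ≤ ENNReal.ofReal (((M : ℝ) ^ 2)⁻¹) * (2 * (M : ℝ≥0∞)) := by
            gcongr; exact loopEnergy_pathPotential_le _ _ _
        _ = ENNReal.ofReal (2 / M) := by
            rw [← ENNReal.ofReal_natCast M, ← ENNReal.ofReal_ofNat 2,
              ← ENNReal.ofReal_mul (by positivity), ← ENNReal.ofReal_mul (by positivity)]
            congr 1
            field_simp
        _ ≤ ENNReal.ofReal (2 / m) := by
            refine ENNReal.ofReal_le_ofReal ?_
            gcongr

/-! ### Cutsets -/

/-- Some vertex of the tree has loop depth at least `r`. -/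
def Reaches (r : ℕ) (d : List ℕ → ℕ) : Prop :=
  ∃ y ∈ (PlaneTree.ofOut d).verts, r ≤ loopDepth d y

open scoped Classical in
/-- A list of path potentials that together cut the root off from large loop depths, when all loop
depths are increased by `a`. A potential is recorded as the end vertex of its path and its height
in the loop of this vertex. There are two kinds: height `0` at the vertices where the depth reaches
`m` for the first time, without reaching `2 m`, and from which a further depth `r` is reached; and
height `m` in the loops with at least `2 m` children at a vertex of depth less than `m`. In a loop
of the second kind one potential blocks both sides. The third argument bounds the number of
generations that are searched; as every step has positive length, `m - a` of them suffice. -/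
def cutList (m r : ℕ) : ℕ → ℕ → (List ℕ → ℕ) → List (List ℕ × ℕ)
  | 0, a, d => if a < 2 * m ∧ Reaches r d then [([], 0)] else []
  | L + 1, a, d =>
    if a < m then
      (if 2 * m ≤ d [] then [([], m)] else []) ++
        (List.range (d [])).flatMap fun i =>
          (cutList m r L (a + loopStep (d []) i) (subtreeAt d i)).map fun p => (i :: p.1, p.2)
    else if a < 2 * m ∧ Reaches r d then [([], 0)] else []

lemma loopStep_pos {k i : ℕ} (hi : i < k) : 0 < loopStep k i := by
  rw [loopStep]; omega

lemma le_loopDepth_of_mem_cutList (m r : ℕ) (L a : ℕ) (d : List ℕ → ℕ) (haL : m ≤ a + L)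
    (p : List ℕ × ℕ) (hp : p ∈ cutList m r L a d) : m ≤ a + (loopDepth d p.1 + p.2) := by
  induction L generalizing a d p with
  | zero => omega
  | succ L ih =>
    by_cases ha : a < m
    · rw [cutList, if_pos ha, List.mem_append] at hp
      rcases hp with hp | hp
      · split_ifs at hp
        · rw [List.mem_singleton] at hp
          simp [hp, loopDepth]
        · simp at hp
      · obtain ⟨i, hi, hp⟩ := List.mem_flatMap.1 hp
        obtain ⟨q, hq, rfl⟩ := List.mem_map.1 hp
        have := loopStep_pos (List.mem_range.1 hi)
        have := ih _ _ (by omega) q hq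
        simp only [loopDepth]
        omega
    · omega

/-- The potentials of `cutList` separate the root from all vertices of loop depth `≥ n`: on the way
to such a vertex, either the step that first reaches depth `m` is longer than `m`, which requires a
large loop, or it ends below depth `2 m`, and then a further depth `n - 2 m` is reached. -/
lemma exists_mem_cutList (m n : ℕ) (hmn : m ≤ n) (L a : ℕ) (d : List ℕ → ℕ)
    (haL : m ≤ a + L) (ha2 : a < 2 * m) (y : List ℕ) (hy : y ∈ (PlaneTree.ofOut d).verts)
    (hyn : n ≤ a + loopDepth d y) :
    ∃ p ∈ cutList m (n - 2 * m) L a d,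
      loopDepth d p.1 + p.2 ≤ pathPotential p.2 d p.1 y := by
  induction L generalizing a d y with
  | zero =>
    have : Reaches (n - 2 * m) d := ⟨y, hy, by omega⟩
    exact ⟨([], 0), by simp [cutList, ha2, this], by simp [loopDepth]⟩
  | succ L ih =>
    by_cases ha : a < m
    · rw [cutList, if_pos ha]
      cases y with
      | nil => simp only [loopDepth] at hyn; omega
      | cons i y =>
        obtain ⟨hi, hy'⟩ := cons_mem_verts_ofOut.1 hy
        by_cases hs : m < loopStep (d []) i
        · have hd : 2 * m ≤ d [] := by rw [loopStep] at hs; omega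
          refine ⟨([], m), by simp [hd], ?_⟩
          simp only [loopDepth, pathPotential]
          omega
        · have hpos := loopStep_pos hi
          obtain ⟨p, hp, hpy⟩ := ih (a + loopStep (d []) i) (subtreeAt d i) (by omega) (by omega) y
            hy' (by simp only [loopDepth] at hyn; omega)
          refine ⟨(i :: p.1, p.2), List.mem_append_right _ (List.mem_flatMap.2 ⟨i,
            List.mem_range.2 hi, List.mem_map.2 ⟨p, hp, rfl⟩⟩), ?_⟩
          simp only [loopDepth, pathPotential, if_true]
          omega
    · have : Reaches (n - 2 * m) d := ⟨y, hy, by omega⟩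
      exact ⟨([], 0), by simp [cutList, ha, ha2, this], by simp [loopDepth]⟩

/-- The number of potentials in `cutList`. -/
def cutCount (m r L a : ℕ) (d : List ℕ → ℕ) : ℝ≥0∞ := ((cutList m r L a d).length : ℕ)

/-- The effective resistance to the complement of a ball is bounded below in terms of the size of
a cutset at scale `m`. -/
lemma inv_le_effectiveResistance (d : List ℕ → ℕ) {m n : ℕ} (hm : 0 < m) (hmn : m ≤ n) :
    (cutCount m (n - 2 * m) m 0 d * ENNReal.ofReal (2 / m))⁻¹ ≤
      effectiveResistance (PlaneTree.ofOut d).loop {(PlaneTree.ofOut d).loopRoot}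
        (graphBall (PlaneTree.ofOut d).loop (PlaneTree.ofOut d).loopRoot n)ᶜ := by
  obtain ⟨h, h1, -, h3, h4⟩ := exists_testFunction d hm (cutList m (n - 2 * m) m 0 d)
    fun p hp => by simpa using le_loopDepth_of_mem_cutList m (n - 2 * m) m 0 d (by omega) p hp
  refine ENNReal.inv_le_inv.2 (le_trans ?_ h4)
  refine (iInf₂_le (fun x => h x.1) ⟨?_, ?_⟩).trans (dirichletEnergy_le_loopEnergy d h)
  · rintro _ rfl
    exact h1
  · rintro ⟨y, hy⟩ hyb
    refine h3 y (exists_mem_cutList m n hmn m 0 d (by omega) (by omega) y hy ?_)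
    by_contra hlt
    refine hyb ?_
    rw [graphBall, SimpleGraph.mem_ball]
    refine (edist_root_le_loopDepth d y hy).trans_lt ?_
    exact_mod_cast (by omega : loopDepth d y < n)

/-! ### Splitting off a coordinate of a product measure -/

/-- Gluing one independent coordinate to an i.i.d. family gives an i.i.d. family. Here `e₀` is the
new index, `f` embeds the old indices, and `G` is the gluing map. -/
lemma map_glue_infinitePi {ι κ X : Type*} [MeasurableSpace X] (ν : Measure X)
    [IsProbabilityMeasure ν] (e₀ : ι) (f : κ → ι) (hf : Function.Injective f)
    (h0 : ∀ k, f k ≠ e₀) (hs : ∀ i, i = e₀ ∨ ∃ k, f k = i) (G : X × (κ → X) → ι → X)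
    (hG0 : ∀ p, G p e₀ = p.1) (hGf : ∀ p k, G p (f k) = p.2 k) :
    Measurable G ∧
      (ν.prod (Measure.infinitePi fun _ : κ => ν)).map G = Measure.infinitePi fun _ : ι => ν := by
  classical
  have hG : Measurable G := by
    refine measurable_pi_iff.2 fun i => ?_
    rcases hs i with rfl | ⟨k, rfl⟩
    · simpa only [hG0] using measurable_fst
    · simp only [hGf]
      fun_prop
  refine ⟨hG, Measure.eq_infinitePi _ fun s t ht => ?_⟩
  rw [Measure.map_apply hG (.pi s.countable_toSet fun _ _ => ht _)]
  have hpre : G ⁻¹' (s : Set ι).pi t = (if e₀ ∈ s then t e₀ else Set.univ) ×ˢ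
      ((s.preimage f hf.injOn : Finset κ) : Set κ).pi fun k => t (f k) := by
    ext p
    simp only [Set.mem_preimage, Set.mem_pi, Set.mem_prod, Finset.mem_coe, Finset.mem_preimage]
    constructor
    · intro h
      refine ⟨?_, fun k hk => hGf p k ▸ h _ hk⟩
      split_ifs with he
      · exact hG0 p ▸ h _ he
      · trivial
    · rintro ⟨h1, h2⟩ i hi
      rcases hs i with rfl | ⟨k, rfl⟩
      · rw [if_pos hi] at h1
        exact (hG0 p).symm ▸ h1
      · exact (hGf p k).symm ▸ h2 k hi
  have hprod : ∏ i ∈ s, ν (t i) =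
      (if e₀ ∈ s then ν (t e₀) else 1) * ∏ k ∈ s.preimage f hf.injOn, ν (t (f k)) := by
    have h1 := Finset.prod_preimage f s hf.injOn (fun i => if i = e₀ then 1 else ν (t i)) (by
      intro i _ hi
      rcases hs i with rfl | ⟨k, rfl⟩
      · simp
      · exact absurd ⟨k, rfl⟩ hi)
    simp only [h0, if_false] at h1
    rw [h1]
    have h2 : (if e₀ ∈ s then ν (t e₀) else 1) = ∏ i ∈ s, if i = e₀ then ν (t i) else 1 := by
      rw [Finset.prod_ite_eq']
    rw [h2, ← Finset.prod_mul_distrib]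
    refine Finset.prod_congr rfl fun i _ => ?_
    split_ifs <;> simp
  rw [hpre, Measure.prod_prod, Measure.infinitePi_pi _ fun i _ => ht _, hprod]
  congr 1
  split_ifs <;> simp

/-- The offspring numbers of independent normal vertices. -/
def treeMeasure (π : PMF ℕ) : Measure (List ℕ → ℕ) := Measure.infinitePi fun _ => π.toMeasure

/-- The laws of the choices made at the special vertices. -/
def spineChoiceMeasure (π : PMF ℕ) (hπ : IsCritical π) : Measure (ℕ → ℕ × ℕ) :=
  Measure.infinitePi fun _ => (specialOffspring π hπ).toMeasure

instance (π : PMF ℕ) : IsProbabilityMeasure (treeMeasure π) := by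
  unfold treeMeasure; infer_instance

instance (π : PMF ℕ) (hπ : IsCritical π) : IsProbabilityMeasure (spineChoiceMeasure π hπ) := by
  unfold spineChoiceMeasure; infer_instance

lemma spineMeasure_eq (π : PMF ℕ) (hπ : IsCritical π) :
    spineMeasure π hπ = (treeMeasure π).prod (spineChoiceMeasure π hπ) := rfl

instance (π : PMF ℕ) (hπ : IsCritical π) : IsProbabilityMeasure (spineMeasure π hπ) := by
  rw [spineMeasure_eq]; infer_instance

/-- The tree whose root has `p.1` children, with the subtrees `p.2 i`. -/
def graft (p : ℕ × (ℕ → List ℕ → ℕ)) : List ℕ → ℕ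
  | [] => p.1
  | i :: v => p.2 i v

/-- The branching property: the number of children of the root and the subtrees of the children
are independent. -/
lemma measurePreserving_graft (π : PMF ℕ) :
    MeasurePreserving graft (π.toMeasure.prod (Measure.infinitePi fun _ : ℕ => treeMeasure π))
      (treeMeasure π) := by
  let G : ℕ × (ℕ × List ℕ → ℕ) → List ℕ → ℕ := fun p v => match v with
    | [] => p.1
    | i :: v => p.2 (i, v)
  have h1 := map_glue_infinitePi π.toMeasure ([] : List ℕ) (fun p : ℕ × List ℕ => p.1 :: p.2)
    (by rintro ⟨i, v⟩ ⟨j, w⟩ h; simpa using h) (by simp)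
    (by rintro (_ | ⟨i, v⟩) <;> simp) G (fun _ => rfl) (fun _ _ => rfl)
  have h2 := Measure.infinitePi_map_curry_symm (ι := ℕ) (κ := List ℕ) (X := ℕ)
    (fun _ _ => π.toMeasure)
  have hG : graft = G ∘ Prod.map id (MeasurableEquiv.curry ℕ (List ℕ) ℕ).symm := by
    funext p v
    cases v <;> rfl
  have hm : Measurable (Prod.map (id : ℕ → ℕ) (MeasurableEquiv.curry ℕ (List ℕ) ℕ).symm) := by
    fun_prop
  refine ⟨hG ▸ h1.1.comp hm, ?_⟩
  rw [hG, ← Measure.map_map h1.1 hm, ← Measure.map_prod_map _ _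
    measurable_id (MeasurableEquiv.measurable _), Measure.map_id]
  exact (congrArg (fun ρ => (π.toMeasure.prod ρ).map G) h2).trans h1.2

lemma measurable_subtreeAt (i : ℕ) : Measurable fun d : List ℕ → ℕ => subtreeAt d i :=
  measurable_pi_iff.2 fun v => measurable_pi_apply (i :: v)

lemma measurePreserving_subtreeAt (π : PMF ℕ) (i : ℕ) :
    MeasurePreserving (fun d => subtreeAt d i) (treeMeasure π) (treeMeasure π) := by
  refine ⟨measurable_subtreeAt i, ?_⟩
  nth_rw 1 [← (measurePreserving_graft π).map_eq]
  rw [Measure.map_map (measurable_subtreeAt i) (measurePreserving_graft π).measurable]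
  have : (fun d => subtreeAt d i) ∘ graft = (fun e => e i) ∘ Prod.snd := rfl
  rw [this, ← Measure.map_map (measurable_pi_apply i) measurable_snd, Measure.map_snd_prod,
    measure_univ, one_smul]
  exact Measure.infinitePi_map_eval (fun _ : ℕ => treeMeasure π) i

lemma lintegral_pmf {α : Type*} [Countable α] [MeasurableSpace α] [MeasurableSingletonClass α]
    (π : PMF α) (f : α → ℝ≥0∞) : ∫⁻ k, f k ∂π.toMeasure = ∑' k, π k * f k := by
  rw [lintegral_countable']
  refine tsum_congr fun k => ?_
  rw [PMF.toMeasure_apply_singleton _ _ (measurableSet_singleton k), mul_comm]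

lemma lintegral_treeMeasure (π : PMF ℕ) {F : (List ℕ → ℕ) → ℝ≥0∞} (hF : Measurable F) :
    ∫⁻ d, F d ∂treeMeasure π =
      ∑' k, π k * ∫⁻ e, F (graft (k, e)) ∂(Measure.infinitePi fun _ : ℕ => treeMeasure π) := by
  rw [← (measurePreserving_graft π).lintegral_comp hF, lintegral_prod (fun p => F (graft p))
    (hF.comp (measurePreserving_graft π).measurable).aemeasurable, lintegral_pmf]

/-! ### Measurability -/

lemma measurable_loopDepth (y : List ℕ) : Measurable fun d : List ℕ → ℕ => loopDepth d y := by
  induction y with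
  | nil => exact measurable_const
  | cons i y ih =>
    exact ((Measurable.of_discrete (f := fun k => loopStep k i)).comp
      (measurable_pi_apply [])).add (ih.comp (measurable_subtreeAt i))

lemma measurableSet_mem_verts (y : List ℕ) :
    MeasurableSet {d : List ℕ → ℕ | y ∈ (PlaneTree.ofOut d).verts} := by
  induction y with
  | nil => simp [PlaneTree.nil_mem]
  | cons i y ih =>
    simp only [cons_mem_verts_ofOut]
    exact (measurableSet_lt measurable_const (measurable_pi_apply [])).inter
      (measurable_subtreeAt i ih)

lemma measurableSet_reaches (r : ℕ) : MeasurableSet {d : List ℕ → ℕ | Reaches r d} := by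
  have : {d : List ℕ → ℕ | Reaches r d} =
      ⋃ y, {d | y ∈ (PlaneTree.ofOut d).verts} ∩ {d | r ≤ loopDepth d y} := by
    ext d; simp [Reaches]
  rw [this]
  exact .iUnion fun y => (measurableSet_mem_verts y).inter
    (measurableSet_le measurable_const (measurable_loopDepth y))

open scoped Classical in
lemma cutCount_of_le {m a : ℕ} (ha : m ≤ a) (r L : ℕ) (d : List ℕ → ℕ) :
    cutCount m r L a d = if a < 2 * m ∧ Reaches r d then 1 else 0 := by
  cases L
  · rw [cutCount, cutList]
    split_ifs <;> simp
  · rw [cutCount, cutList, if_neg ha.not_gt]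
    split_ifs <;> simp

lemma cutCount_succ {m a : ℕ} (ha : a < m) (r L : ℕ) (d : List ℕ → ℕ) :
    cutCount m r (L + 1) a d = (if 2 * m ≤ d [] then 1 else 0) +
      ∑ i ∈ Finset.range (d []), cutCount m r L (a + loopStep (d []) i) (subtreeAt d i) := by
  have hsum : ∀ (f : ℕ → ℕ) k, ((List.range k).map f).sum = ∑ i ∈ Finset.range k, f i := by
    intro f k
    induction k with
    | zero => simp
    | succ k ih => simp [List.range_succ, Finset.sum_range_succ, ih]
  simp only [cutCount]
  rw [cutList, if_pos ha, List.length_append, List.length_flatMap, hsum]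
  simp only [List.length_map, Nat.cast_add, Nat.cast_sum]
  congr 1
  split_ifs <;> simp

lemma measurable_root_subtreeAt (F : ℕ → (List ℕ → ℕ) → ℝ≥0∞) (hF : ∀ k, Measurable (F k))
    (i : ℕ) : Measurable fun d : List ℕ → ℕ => F (d []) (subtreeAt d i) := by
  have h2 : Measurable fun q : ℕ × (List ℕ → ℕ) => F q.1 q.2 :=
    measurable_from_prod_countable_right hF
  have h3 : Measurable fun d : List ℕ → ℕ => (d [], subtreeAt d i) :=
    (measurable_pi_apply []).prodMk (measurable_subtreeAt i)
  exact h2.comp h3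

lemma measurable_cutCount (m r L a : ℕ) : Measurable (cutCount m r L a) := by
  classical
  have hbase : ∀ a, Measurable fun d : List ℕ → ℕ =>
      if a < 2 * m ∧ Reaches r d then (1 : ℝ≥0∞) else 0 := by
    intro a
    refine Measurable.ite ?_ measurable_const measurable_const
    exact (MeasurableSet.const _).inter (measurableSet_reaches r)
  induction L generalizing a with
  | zero =>
    have : cutCount m r 0 a = fun d => if a < 2 * m ∧ Reaches r d then (1 : ℝ≥0∞) else 0 := by
      funext d
      rw [cutCount, cutList]
      split_ifs <;> simp
    rw [this]
    exact hbase a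
  | succ L ih =>
    by_cases ha : a < m
    · have : cutCount m r (L + 1) a = fun d => (if 2 * m ≤ d [] then 1 else 0) +
          ∑' i, if i < d [] then cutCount m r L (a + loopStep (d []) i) (subtreeAt d i) else 0 := by
        funext d
        rw [cutCount_succ ha, tsum_eq_sum (s := Finset.range (d []))
          (fun i hi => if_neg (by simpa using hi))]
        congr 1
        exact Finset.sum_congr rfl fun i hi => (if_pos (Finset.mem_range.1 hi)).symm
      rw [this]
      have h1 : ∀ i, Measurable fun d : List ℕ → ℕ =>
          cutCount m r L (a + loopStep (d []) i) (subtreeAt d i) := fun i =>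
        measurable_root_subtreeAt (fun k => cutCount m r L (a + loopStep k i)) (fun k => ih _) i
      have h4 : ∀ i, Measurable fun d : List ℕ → ℕ => if i < d [] then
          cutCount m r L (a + loopStep (d []) i) (subtreeAt d i) else 0 := fun i =>
        (h1 i).ite (measurableSet_lt measurable_const (measurable_pi_apply [])) measurable_const
      have h5 : Measurable fun d : List ℕ → ℕ => if 2 * m ≤ d [] then (1 : ℝ≥0∞) else 0 :=
        measurable_const.ite (measurableSet_le measurable_const (measurable_pi_apply []))
          measurable_const
      exact h5.add (Measurable.tsum h4)
    · have : cutCount m r (L + 1) a =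
          fun d => if a < 2 * m ∧ Reaches r d then (1 : ℝ≥0∞) else 0 := by
        funext d
        rw [cutCount_of_le (not_lt.1 ha)]
      rw [this]
      exact hbase a

/-! ### The reach of a critical looptree -/

/-- The probability that a tree of normal vertices contains a vertex of loop depth `≥ r`. -/
def reachProb (π : PMF ℕ) (r : ℕ) : ℝ≥0∞ := treeMeasure π {d | Reaches r d}

lemma reachProb_le_one (π : PMF ℕ) (r : ℕ) : reachProb π r ≤ 1 := prob_le_one

lemma reaches_iff {r : ℕ} (hr : 0 < r) (d : List ℕ → ℕ) :
    Reaches r d ↔ ∃ i < d [], Reaches (r - loopStep (d []) i) (subtreeAt d i) := by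
  constructor
  · rintro ⟨y, hy, hry⟩
    cases y with
    | nil => simp only [loopDepth] at hry; omega
    | cons i y =>
      obtain ⟨hi, hy⟩ := cons_mem_verts_ofOut.1 hy
      exact ⟨i, hi, y, hy, by simp only [loopDepth] at hry; omega⟩
  · rintro ⟨i, hi, y, hy, hry⟩
    exact ⟨i :: y, cons_mem_verts_ofOut.2 ⟨hi, hy⟩, by simp only [loopDepth]; omega⟩

lemma reachProb_eq (π : PMF ℕ) {r : ℕ} (hr : 0 < r) :
    reachProb π r = ∑' k, π k *
      (1 - ∏ i ∈ Finset.range k, (1 - reachProb π (r - loopStep k i))) := by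
  classical
  rw [reachProb, ← lintegral_indicator_one (measurableSet_reaches r), lintegral_treeMeasure π
    (measurable_one.indicator (measurableSet_reaches r))]
  refine tsum_congr fun k => ?_
  congr 1
  set S : Set (ℕ → List ℕ → ℕ) := (Finset.range k : Set ℕ).pi
    fun i => {d | Reaches (r - loopStep k i) d}ᶜ with hS
  have hSm : MeasurableSet S := .pi (Finset.range k).countable_toSet
    fun i _ => (measurableSet_reaches _).compl
  have h1 : (fun e => ({d | Reaches r d} : Set (List ℕ → ℕ)).indicator (1 : (List ℕ → ℕ) → ℝ≥0∞)
      (graft (k, e))) = Sᶜ.indicator 1 := by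
    funext e
    simp only [Set.indicator, Set.mem_ofPred_eq, Pi.one_apply]
    refine if_congr ?_ rfl rfl
    rw [reaches_iff hr]
    simp only [hS, Set.mem_compl_iff, Set.mem_pi, Finset.mem_coe, Finset.mem_range,
      Set.mem_ofPred_eq, not_forall, not_not, exists_prop]
    rfl
  rw [h1, lintegral_indicator_one hSm.compl, prob_compl_eq_one_sub hSm, hS,
    Measure.infinitePi_pi _ fun i _ => (measurableSet_reaches _).compl]
  simp only [prob_compl_eq_one_sub (measurableSet_reaches _)]
  rfl

/-- A quantitative second-order improvement on Bernoulli's inequality. -/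
lemma one_sub_pow_bound (x : ℝ) (hx0 : 0 ≤ x) (hx1 : x ≤ 1) (k : ℕ) (hk : 1 ≤ k) :
    1 - (1 - x) ^ k ≤ k * x / (1 + (k - 1) * x / 2) := by
  have key : ∀ k : ℕ, 1 ≤ k → 1 - (k + 1) * x / 2 ≤ (1 - x) ^ k * (1 + (k - 1) * x / 2) := by
    intro k hk
    induction k, hk using Nat.le_induction with
    | base => norm_num
    | succ k hk ih =>
      have hk1 : (1 : ℝ) ≤ k := by exact_mod_cast hk
      have hpos : 0 < 1 + ((k : ℝ) - 1) * x / 2 := by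
        have := mul_nonneg (sub_nonneg.2 hk1) hx0
        linarith
      have hpos' : 0 ≤ 1 + (k : ℝ) * x / 2 := by positivity
      have h2 : (1 - ((k : ℝ) + 2) * x / 2) * (1 + (k - 1) * x / 2) ≤
          (1 - x) * (1 - (k + 1) * x / 2) * (1 + k * x / 2) := by
        have : 0 ≤ (k : ℝ) * (k + 1) * x ^ 3 := by positivity
        nlinarith
      have h3 := mul_le_mul_of_nonneg_right (mul_le_mul_of_nonneg_left ih (sub_nonneg.2 hx1)) hpos'
      push_cast
      refine le_of_mul_le_mul_right ?_ hpos
      calc _ = (1 - ((k : ℝ) + 2) * x / 2) * (1 + (k - 1) * x / 2) := by ring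
        _ ≤ _ := h2.trans h3
        _ = _ := by ring
  have hk1 : (1 : ℝ) ≤ k := by exact_mod_cast hk
  have hpos : 0 < 1 + ((k : ℝ) - 1) * x / 2 := by
    have := mul_nonneg (sub_nonneg.2 hk1) hx0
    linarith
  rw [le_div_iff₀ hpos]
  have := key k hk
  nlinarith

lemma two_mul_loopStep_le (k i : ℕ) : 2 * loopStep k i ≤ k + 1 := by
  rw [loopStep]; omega

/-- The contribution of a root with `k ≥ 2` children to the probability of reaching depth `r`. The
shift by `1 / 4` is the gain from the interaction of the children; it outweighs the depth lost in
the first loop as soon as `A ≥ 6`. -/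
lemma one_sub_prod_le (P : ℕ → ℝ≥0∞) {A : ℝ} (hA : 6 ≤ A) {r k : ℕ}
    (hk : 2 ≤ k) (ih : ∀ r' < r, 0 < r' → P r' ≤ ENNReal.ofReal (A / r')) (hrA : A < r) :
    1 - ∏ i ∈ Finset.range k, (1 - P (r - loopStep k i)) ≤
      k * ENNReal.ofReal (1 / (r / A + 1 / 4)) := by
  have hk2 : (2 : ℝ) ≤ k := by exact_mod_cast hk
  have hA0 : 0 < A := by linarith
  have hr0 : (0 : ℝ) < r := by linarith
  have hden : 0 < (r : ℝ) / A + 1 / 4 := by positivity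
  rw [← ENNReal.ofReal_natCast k, ← ENNReal.ofReal_mul (by positivity), mul_one_div]
  -- No child is further than `(k + 1) / 2` from the root.
  by_cases hcase : (r : ℝ) - (k + 1) / 2 ≤ A
  · refine tsub_le_self.trans ?_
    rw [← ENNReal.ofReal_one]
    refine ENNReal.ofReal_le_ofReal ?_
    rw [one_le_div hden]
    have : (r : ℝ) / A ≤ 1 + (k + 1) / 12 := by
      rw [div_le_iff₀ hA0]
      nlinarith
    linarith
  · push Not at hcase
    set x : ℝ := A / (r - (k + 1) / 2) with hx
    have hD : 0 < (r : ℝ) - (k + 1) / 2 := by linarith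
    have hx0 : 0 < x := by positivity
    have hx1 : x ≤ 1 := by rw [hx, div_le_one hD]; exact hcase.le
    have hPi : ∀ i ∈ Finset.range k, ENNReal.ofReal (1 - x) ≤ 1 - P (r - loopStep k i) := by
      intro i hi
      have h1 := loopStep_pos (Finset.mem_range.1 hi)
      have h2 := two_mul_loopStep_le k i
      have h2' : (2 : ℝ) * loopStep k i ≤ k + 1 := by exact_mod_cast h2
      have h3 : loopStep k i < r := by
        have : (loopStep k i : ℝ) < r := by linarith
        exact_mod_cast this
      rw [ENNReal.ofReal_sub _ hx0.le, ENNReal.ofReal_one]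
      refine tsub_le_tsub_left ((ih _ (by omega) (by omega)).trans ?_) 1
      refine ENNReal.ofReal_le_ofReal ?_
      rw [Nat.cast_sub h3.le, hx]
      exact div_le_div_of_nonneg_left hA0.le hD (by linarith)
    have hprod : ENNReal.ofReal ((1 - x) ^ k) ≤
        ∏ i ∈ Finset.range k, (1 - P (r - loopStep k i)) := by
      rw [ENNReal.ofReal_pow (by linarith)]
      calc ENNReal.ofReal (1 - x) ^ k = ∏ _i ∈ Finset.range k, ENNReal.ofReal (1 - x) := by simp
        _ ≤ _ := Finset.prod_le_prod' hPi
    refine (tsub_le_tsub_left hprod 1).trans ?_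
    rw [← ENNReal.ofReal_one, ← ENNReal.ofReal_sub _ (pow_nonneg (by linarith) k)]
    refine ENNReal.ofReal_le_ofReal ((one_sub_pow_bound x hx0.le hx1 k (by omega)).trans ?_)
    have hpos : 0 < 1 + ((k : ℝ) - 1) * x / 2 := by
      have := mul_nonneg (by linarith : (0 : ℝ) ≤ (k : ℝ) - 1) hx0.le
      linarith
    rw [div_le_div_iff₀ hpos hden]
    have hrx : (r : ℝ) / A * x = 1 + (k + 1) / 2 / A * x := by
      have h5 : ((r : ℝ) - (k + 1) / 2) / A * x = 1 := by
        rw [hx, div_mul_div_comm, mul_comm, div_self (by positivity)]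
      linear_combination h5
    have hb : ((k : ℝ) + 1) / 2 / A ≤ (k + 1) / 12 := by
      rw [div_div]
      exact div_le_div_of_nonneg_left (by positivity) (by norm_num) (by linarith)
    have : x * (r / A + 1 / 4) ≤ 1 + (k - 1) * x / 2 := by
      have h4 : x * ((k + 1) / 2 / A) ≤ x * ((k + 1) / 12) := by gcongr
      nlinarith
    calc (k : ℝ) * x * (r / A + 1 / 4) = k * (x * (r / A + 1 / 4)) := by ring
      _ ≤ _ := by gcongr

lemma tsum_eq_one_add_ite (f : ℕ → ℝ≥0∞) :
    ∑' k, f k = f 1 + ∑' k, if k = 1 then 0 else f k := by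
  rw [ENNReal.tsum_eq_add_tsum_ite 1]
  congr!

/-- The looptree of a critical tree that is not a single ray reaches depth `r` with probability
`O(1 / r)`. In the recursion over the children of the root, the gain of `one_sub_prod_le` for two
or more children compensates the loss of one unit of depth at a root with a single child. -/
lemma exists_reachProb_le (π : PMF ℕ) (hπ : IsCritical π) (h1 : π 1 ≠ 1) :
    ∃ A : ℝ, 0 < A ∧ ∀ r : ℕ, 0 < r → reachProb π r ≤ ENNReal.ofReal (A / r) := by
  have hp1 : π 1 < 1 := lt_of_le_of_ne (π.coe_le_one 1) h1
  set ρ : ℝ := (π 1).toReal with hρ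
  have hπ1 : π 1 = ENNReal.ofReal ρ := (ENNReal.ofReal_toReal hp1.ne_top).symm
  have hρ0 : 0 ≤ ρ := ENNReal.toReal_nonneg
  have hρ1 : ρ < 1 := by
    rw [hρ, ← ENNReal.toReal_one]
    exact (ENNReal.toReal_lt_toReal hp1.ne_top ENNReal.one_ne_top).2 hp1
  have hrest : ∑' k : ℕ, (if k = 1 then 0 else (k : ℝ≥0∞) * π k) = ENNReal.ofReal (1 - ρ) := by
    have h := hπ
    rw [IsCritical, tsum_eq_one_add_ite, Nat.cast_one, one_mul] at h
    rw [ENNReal.ofReal_sub _ hρ0, ← hπ1, ENNReal.ofReal_one]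
    exact ENNReal.eq_sub_of_add_eq hp1.ne_top ((add_comm _ _).trans h)
  -- The larger the chance of a single child, the larger `A` has to be for the gain to prevail.
  set A : ℝ := max 6 (10 / (1 - ρ)) with hA
  have hA6 : 6 ≤ A := le_max_left _ _
  have hA10 : 10 ≤ A * (1 - ρ) := by
    rw [← div_le_iff₀ (by linarith)]; exact le_max_right _ _
  have hA0 : 0 < A := by linarith
  refine ⟨A, hA0, fun r => ?_⟩
  induction r using Nat.strong_induction_on with
  | _ r ih =>
  intro hr
  have hr0 : (0 : ℝ) < r := by exact_mod_cast hr
  by_cases hrA : (r : ℝ) ≤ A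
  · refine (reachProb_le_one π r).trans ?_
    rw [← ENNReal.ofReal_one]
    refine ENNReal.ofReal_le_ofReal ?_
    rwa [one_le_div hr0]
  push Not at hrA
  have hr1 : (0 : ℝ) < r - 1 := by linarith
  rw [reachProb_eq π hr]
  have hterm : ∀ k : ℕ, π k * (1 - ∏ i ∈ Finset.range k, (1 - reachProb π (r - loopStep k i))) ≤
      if k = 1 then π 1 * ENNReal.ofReal (A / (r - 1)) else
        (if k = 1 then 0 else (k : ℝ≥0∞) * π k) * ENNReal.ofReal (1 / (r / A + 1 / 4)) := by
    intro k
    split_ifs with hk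
    · subst hk
      gcongr
      rw [Finset.prod_range_one, ENNReal.sub_sub_cancel ENNReal.one_ne_top (reachProb_le_one _ _)]
      have h1r : 1 < r := by
        have : (1 : ℝ) < r := by linarith
        exact_mod_cast this
      have := ih (r - 1) (by omega) (by omega)
      rwa [Nat.cast_sub hr, Nat.cast_one] at this
    · rcases Nat.eq_zero_or_pos k with rfl | hk0
      · simp
      · rw [mul_comm (k : ℝ≥0∞), mul_assoc]
        gcongr
        exact one_sub_prod_le _ hA6 (by omega)
          (fun r' hr' h0 => ih r' hr' h0) hrA
  refine (ENNReal.tsum_le_tsum hterm).trans ?_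
  rw [tsum_eq_one_add_ite, if_pos rfl]
  have hsimp : ∀ k : ℕ, (if k = 1 then 0 else if k = 1 then π 1 * ENNReal.ofReal (A / (r - 1)) else
        (if k = 1 then 0 else (k : ℝ≥0∞) * π k) * ENNReal.ofReal (1 / (r / A + 1 / 4))) =
      (if k = 1 then 0 else (k : ℝ≥0∞) * π k) * ENNReal.ofReal (1 / (r / A + 1 / 4)) := by
    intro k
    split_ifs <;> simp
  simp only [hsimp]
  rw [ENNReal.tsum_mul_right, hrest, hπ1, ← ENNReal.ofReal_mul hρ0,
    ← ENNReal.ofReal_mul (by linarith), ← ENNReal.ofReal_add (by positivity)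
      (mul_nonneg (by linarith) (by positivity))]
  refine ENNReal.ofReal_le_ofReal ?_
  have e1 : (1 : ℝ) / (r / A + 1 / 4) = A / (r + A / 4) := by field_simp
  have e2 : A / (r - 1) - A / r = A / (r * (r - 1)) := by field_simp; ring
  have e3 : A / r - A / (r + A / 4) = A * (A / 4) / (r * (r + A / 4)) := by field_simp; ring
  rw [e1]
  have e4 : ρ * (A / (r * (r - 1))) ≤ (1 - ρ) * (A * (A / 4) / (r * (r + A / 4))) := by
    rw [← mul_div_assoc, ← mul_div_assoc, div_le_div_iff₀ (by positivity) (by positivity)]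
    have e5 : (r : ℝ) + A / 4 ≤ 5 / 4 * r := by linarith
    have e6 : (r : ℝ) / 2 ≤ r - 1 := by linarith
    have e7 : (r : ℝ) + A / 4 ≤ (1 - ρ) * (A / 4) * (r - 1) := by nlinarith
    calc ρ * A * (r * (r + A / 4)) ≤ 1 * A * (r * ((1 - ρ) * (A / 4) * (r - 1))) := by gcongr
      _ = _ := by ring
  have e8 : ρ * (A / (r - 1)) = ρ * (A / r) + ρ * (A / (r * (r - 1))) := by rw [← e2]; ring
  have e9 : (1 - ρ) * (A / (r + A / 4)) =
    (1 - ρ) * (A / r) - (1 - ρ) * (A * (A / 4) / (r * (r + A / 4))) := by rw [← e3]; ring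
  rw [e8, e9]
  linarith

/-! ### Truncated means -/

/-- The mean of the depth increment along the spine, truncated at `m`. The index of the special
child is uniform, so that the size-biased weight `k π_k` turns into a sum over the children. -/
def meanStep (π : PMF ℕ) (m : ℕ) : ℝ≥0∞ :=
  ∑' k, π k * ((∑ i ∈ Finset.range k, min (loopStep k i) m : ℕ) : ℝ≥0∞)

/-- The mean of the number of children of a special vertex, truncated at `m`. -/
def meanChildren (π : PMF ℕ) (m : ℕ) : ℝ≥0∞ := ∑' k, π k * ((k * min k m : ℕ) : ℝ≥0∞)

/-- The distances in a loop with `k` children are of order `k` on average. The product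
`(i + 1) * (k - i)` of the two ways round the loop is at most `k` times the shorter one. -/
lemma six_mul_sum_loopStep (k : ℕ) : k * k ≤ 6 * ∑ i ∈ Finset.range k, loopStep k i := by
  have hsum : ∀ n ≤ k, ((6 * ∑ i ∈ Finset.range n, (i + 1) * (k - i) : ℕ) : ℤ) =
      n * (n + 1) * (3 * k - 2 * n + 2) := by
    intro n
    induction n with
    | zero => simp
    | succ n ih =>
      intro hn
      rw [Finset.sum_range_succ, mul_add, Nat.cast_add, ih (by omega)]
      push_cast [Nat.cast_sub (by omega : n ≤ k)]
      ring
  have h1 : 6 * ∑ i ∈ Finset.range k, (i + 1) * (k - i) = k * (k + 1) * (k + 2) := by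
    have := hsum k le_rfl
    zify
    push_cast at this
    rw [this]; ring
  have h2 : ∑ i ∈ Finset.range k, (i + 1) * (k - i) ≤ k * ∑ i ∈ Finset.range k, loopStep k i := by
    rw [Finset.mul_sum]
    refine Finset.sum_le_sum fun i hi => ?_
    rw [Finset.mem_range] at hi
    rw [loopStep, ← min_mul_max, mul_comm]
    exact Nat.mul_le_mul_right _ (by omega)
  rcases Nat.eq_zero_or_pos k with rfl | hk
  · simp
  · refine Nat.le_of_mul_le_mul_left ?_ hk
    nlinarith

lemma mul_min_le_sum_min_loopStep (k m : ℕ) :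
    k * min k m ≤ 6 * ∑ i ∈ Finset.range k, min (loopStep k i) m := by
  rcases Nat.eq_zero_or_pos k with rfl | hk
  · simp
  refine Nat.le_of_mul_le_mul_left ?_ hk
  have h1 : min k m * ∑ i ∈ Finset.range k, loopStep k i ≤
      k * ∑ i ∈ Finset.range k, min (loopStep k i) m := by
    rw [Finset.mul_sum, Finset.mul_sum]
    refine Finset.sum_le_sum fun i hi => ?_
    have h2 : loopStep k i ≤ k := by
      have := two_mul_loopStep_le k i
      omega
    rcases le_total (loopStep k i) m with h | h
    · rw [min_eq_left h]; exact Nat.mul_le_mul_right _ (min_le_left _ _)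
    · rw [min_eq_right h, mul_comm k m]; exact Nat.mul_le_mul (min_le_right _ _) h2
  have h3 := six_mul_sum_loopStep k
  calc k * (k * min k m) = min k m * (k * k) := by ring
    _ ≤ min k m * (6 * ∑ i ∈ Finset.range k, loopStep k i) := by gcongr
    _ = 6 * (min k m * ∑ i ∈ Finset.range k, loopStep k i) := by ring
    _ ≤ 6 * (k * ∑ i ∈ Finset.range k, min (loopStep k i) m) := by gcongr
    _ = _ := by ring

lemma meanChildren_le (π : PMF ℕ) (m : ℕ) : meanChildren π m ≤ 6 * meanStep π m := by
  rw [meanChildren, meanStep, ← ENNReal.tsum_mul_left]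
  refine ENNReal.tsum_le_tsum fun k => ?_
  rw [mul_left_comm]
  gcongr
  exact_mod_cast mul_min_le_sum_min_loopStep k m

lemma tsum_mul_natCast {π : PMF ℕ} (hπ : IsCritical π) (c : ℝ≥0∞) :
    ∑' k, π k * (k * c) = c := by
  simp only [← mul_assoc]
  rw [ENNReal.tsum_mul_right]
  simp only [mul_comm (π _)]
  rw [hπ, one_mul]

lemma one_le_meanChildren {π : PMF ℕ} (hπ : IsCritical π) {m : ℕ} (hm : 0 < m) :
    1 ≤ meanChildren π m := by
  rw [← tsum_mul_natCast hπ 1, meanChildren]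
  refine ENNReal.tsum_le_tsum fun k => ?_
  rw [mul_one]
  gcongr
  rcases Nat.eq_zero_or_pos k with rfl | hk
  · simp
  · exact Nat.le_mul_of_pos_right _ (by omega)

lemma meanStep_ne_zero {π : PMF ℕ} (hπ : IsCritical π) {m : ℕ} (hm : 0 < m) :
    meanStep π m ≠ 0 := by
  intro h
  have := (one_le_meanChildren hπ hm).trans (meanChildren_le π m)
  simp [h] at this

lemma meanStep_ne_top {π : PMF ℕ} (hπ : IsCritical π) (m : ℕ) : meanStep π m ≠ ∞ := by
  refine ne_top_of_le_ne_top (ENNReal.natCast_ne_top m) ?_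
  rw [← tsum_mul_natCast hπ m, meanStep]
  refine ENNReal.tsum_le_tsum fun k => ?_
  gcongr
  have : ∑ i ∈ Finset.range k, min (loopStep k i) m ≤ k * m := by
    refine (Finset.sum_le_card_nsmul _ _ m fun i _ => min_le_right _ _).trans ?_
    simp
  exact_mod_cast this

/-- A renewal estimate in the spirit of Wald's identity: if the means `U L a` of a quantity, when
`L` generations are explored from depth `a`, gain at most `B` per generation as long as `a < m`,
then they are controlled by the ratio of `m` and the mean of the truncated depth increment. -/
lemma meanStep_mul_le {π : PMF ℕ} (hπ : IsCritical π) (m : ℕ) (U : ℕ → ℕ → ℝ≥0∞) (A B : ℝ≥0∞)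
    (h0 : ∀ a, U 0 a ≤ A) (hbase : ∀ L a, m ≤ a → U L a ≤ A)
    (hrec : ∀ L a, a < m → U (L + 1) a ≤
      B + ∑' k, π k * ∑ i ∈ Finset.range k, U L (a + loopStep k i)) (L a : ℕ) :
    meanStep π m * U L a ≤ meanStep π m * A + B * ((2 * m - a : ℕ) : ℝ≥0∞) := by
  induction L generalizing a with
  | zero => exact (mul_le_mul_right (h0 a) _).trans le_self_add
  | succ L ih =>
    by_cases ha : a < m
    · set M := meanStep π m with hM
      calc M * U (L + 1) a
          ≤ M * (B + ∑' k, π k * ∑ i ∈ Finset.range k, U L (a + loopStep k i)) := by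
            gcongr; exact hrec L a ha
        _ = M * B + ∑' k, π k * ∑ i ∈ Finset.range k, M * U L (a + loopStep k i) := by
            rw [mul_add, ← ENNReal.tsum_mul_left]
            simp only [← Finset.mul_sum, mul_left_comm M]
        _ ≤ M * B + ∑' k, π k * ∑ i ∈ Finset.range k,
              (M * A + B * ((2 * m - (a + loopStep k i) : ℕ) : ℝ≥0∞)) := by
            gcongr; exact ih _
        _ = M * A + B * (M + ∑' k, π k * ∑ i ∈ Finset.range k,
              ((2 * m - (a + loopStep k i) : ℕ) : ℝ≥0∞)) := by
            simp only [Finset.sum_add_distrib, Finset.sum_const, Finset.card_range, nsmul_eq_mul,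
              mul_add (π _), ← Finset.mul_sum, mul_left_comm (π _) B]
            rw [ENNReal.tsum_add, tsum_mul_natCast hπ, ENNReal.tsum_mul_left]
            ring
        _ ≤ M * A + B * ((2 * m - a : ℕ) : ℝ≥0∞) := by
            gcongr
            rw [← tsum_mul_natCast hπ ((2 * m - a : ℕ) : ℝ≥0∞), hM, meanStep, ← ENNReal.tsum_add]
            refine ENNReal.tsum_le_tsum fun k => ?_
            rw [← mul_add]
            gcongr
            have : ∑ i ∈ Finset.range k, min (loopStep k i) m +
                ∑ i ∈ Finset.range k, (2 * m - (a + loopStep k i)) ≤ k * (2 * m - a) := by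
              rw [← Finset.sum_add_distrib]
              refine (Finset.sum_le_card_nsmul _ _ (2 * m - a) fun i _ => by omega).trans ?_
              simp
            exact_mod_cast this
    · exact (mul_le_mul_right (hbase _ _ (not_lt.1 ha)) _).trans le_self_add

/-! ### Mean size of the cutset in a normal tree -/

/-- The mean size of the cutset in a tree of normal vertices. -/
def normalMean (π : PMF ℕ) (m r L a : ℕ) : ℝ≥0∞ := ∫⁻ d, cutCount m r L a d ∂treeMeasure π

/-- The probability that a normal vertex has at least `n` children. -/
def offspringTail (π : PMF ℕ) (n : ℕ) : ℝ≥0∞ := ∑' k, π k * if n ≤ k then 1 else 0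

lemma cutCount_le_indicator {m r L a : ℕ} (h : L = 0 ∨ m ≤ a) (d : List ℕ → ℕ) :
    cutCount m r L a d ≤ ({d | Reaches r d} : Set (List ℕ → ℕ)).indicator 1 d := by
  classical
  have : cutCount m r L a d = if a < 2 * m ∧ Reaches r d then 1 else 0 := by
    rcases h with rfl | h
    · rw [cutCount, cutList]
      split_ifs <;> simp
    · exact cutCount_of_le h r L d
  rw [this, Set.indicator_apply]
  split_ifs with h1 h2 <;> simp_all

lemma normalMean_le_reachProb (π : PMF ℕ) {m r L a : ℕ} (h : L = 0 ∨ m ≤ a) :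
    normalMean π m r L a ≤ reachProb π r := by
  rw [reachProb, ← lintegral_indicator_one (measurableSet_reaches r)]
  exact lintegral_mono fun d => cutCount_le_indicator h d

lemma normalMean_eq_zero (π : PMF ℕ) {m r L a : ℕ} (hm : 0 < m) (h : 2 * m ≤ a) :
    normalMean π m r L a = 0 := by
  have : ∀ d, cutCount m r L a d = 0 := fun d => by
    rw [cutCount_of_le (by omega), if_neg (by omega)]
  simp [normalMean, this]

lemma normalMean_succ (π : PMF ℕ) {m a : ℕ} (ha : a < m) (r L : ℕ) :
    normalMean π m r (L + 1) a = offspringTail π (2 * m) +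
      ∑' k, π k * ∑ i ∈ Finset.range k, normalMean π m r L (a + loopStep k i) := by
  rw [normalMean, lintegral_treeMeasure π (measurable_cutCount m r (L + 1) a), offspringTail,
    ← ENNReal.tsum_add]
  refine tsum_congr fun k => ?_
  rw [← mul_add]
  congr 1
  have h1 : ∀ e : ℕ → List ℕ → ℕ, cutCount m r (L + 1) a (graft (k, e)) =
      (if 2 * m ≤ k then 1 else 0) +
        ∑ i ∈ Finset.range k, cutCount m r L (a + loopStep k i) (e i) :=
    fun e => cutCount_succ ha r L _
  simp only [h1]
  have h2 : ∀ i, Measurable fun e : ℕ → List ℕ → ℕ =>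
      cutCount m r L (a + loopStep k i) (e i) :=
    fun i => (measurable_cutCount m r L _).comp (measurable_pi_apply i)
  rw [lintegral_add_left measurable_const, lintegral_const, measure_univ, mul_one,
    lintegral_finsetSum _ fun i _ => h2 i]
  congr 1
  refine Finset.sum_congr rfl fun i _ => ?_
  exact (measurePreserving_eval_infinitePi (fun _ : ℕ => treeMeasure π) i).lintegral_comp
    (measurable_cutCount m r L _)

lemma meanStep_mul_normalMean_le {π : PMF ℕ} (hπ : IsCritical π) (m r L a : ℕ) :
    meanStep π m * normalMean π m r L a ≤
      meanStep π m * reachProb π r + offspringTail π (2 * m) * ((2 * m : ℕ) : ℝ≥0∞) := by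
  refine (meanStep_mul_le hπ m (normalMean π m r) (reachProb π r) (offspringTail π (2 * m))
    (fun a => normalMean_le_reachProb π (Or.inl rfl))
    (fun L a h => normalMean_le_reachProb π (Or.inr h))
    (fun L a h => (normalMean_succ π h r L).le) L a).trans ?_
  gcongr
  omega

/-! ### The tree with a spine -/

open scoped Classical in
/-- The offspring numbers of the tree with a spine. -/
def spineOut (ω : SpineData) (v : List ℕ) : ℕ :=
  if v = spineVertex ω v.length then (ω.2 v.length).1 else ω.1 v

/-- The sequence with first term `x`, continued by `s`. -/
def consSeq (x : ℕ × ℕ) (s : ℕ → ℕ × ℕ) : ℕ → ℕ × ℕ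
  | 0 => x
  | n + 1 => s n

lemma spineVertex_consSeq (d d' : List ℕ → ℕ) (x : ℕ × ℕ) (s : ℕ → ℕ × ℕ) (k : ℕ) :
    spineVertex (d, consSeq x s) (k + 1) = x.2 :: spineVertex (d', s) k := by
  induction k with
  | zero => rfl
  | succ k ih => rw [spineVertex, ih, spineVertex]; rfl

lemma spineOut_nil (d : List ℕ → ℕ) (x : ℕ × ℕ) (s : ℕ → ℕ × ℕ) :
    spineOut (d, consSeq x s) [] = x.1 := by
  simp [spineOut, spineVertex, consSeq]

lemma subtreeAt_spineOut (d : List ℕ → ℕ) (x : ℕ × ℕ) (s : ℕ → ℕ × ℕ) (i : ℕ) :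
    subtreeAt (spineOut (d, consSeq x s)) i =
      if i = x.2 then spineOut (subtreeAt d i, s) else subtreeAt d i := by
  funext v
  simp only [subtreeAt, spineOut, List.length_cons,
    spineVertex_consSeq d (fun v => d (i :: v)), List.cons.injEq, consSeq]
  by_cases h : i = x.2
  · simp only [h, true_and, if_true, spineOut]
    rfl
  · simp [h, subtreeAt]

lemma measurable_spineOut : Measurable spineOut := by
  classical
  have hv : ∀ (k : ℕ) (v : List ℕ), MeasurableSet {ω : SpineData | v = spineVertex ω k} := by
    intro k
    induction k with
    | zero => intro v; exact MeasurableSet.const (v = [])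
    | succ k ih =>
      intro v
      rcases List.eq_nil_or_concat' v with rfl | ⟨u, j, rfl⟩
      · simp [spineVertex]
      · have : {ω : SpineData | u ++ [j] = spineVertex ω (k + 1)} =
            {ω | u = spineVertex ω k} ∩ {ω | j = (ω.2 k).2} := by
          ext ω
          simp [spineVertex]
        rw [this]
        exact (ih u).inter (measurableSet_eq_fun measurable_const (by fun_prop))
  refine measurable_pi_iff.2 fun v => ?_
  exact Measurable.ite (hv _ v) (by fun_prop) (by fun_prop)

lemma specialOffspring_apply (π : PMF ℕ) (hπ : IsCritical π) (k j : ℕ) :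
    specialOffspring π hπ (k, j) = if j < k then π k else 0 := by
  rw [specialOffspring, PMF.bind_apply, tsum_eq_single k]
  · have hs : sizeBiased π hπ k = k * π k := rfl
    rw [hs]
    rcases Nat.eq_zero_or_pos k with rfl | hk
    · simp
    · rw [dif_pos hk.ne', PMF.map_apply]
      simp only [Prod.mk.injEq, true_and]
      rw [tsum_eq_single j fun j' hj' => if_neg hj'.symm, if_pos rfl,
        PMF.uniformOfFinset_apply, Finset.card_range]
      simp only [Finset.mem_range]
      split_ifs
      · rw [mul_right_comm, ENNReal.mul_inv_cancel (by simpa using hk.ne')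
          (ENNReal.natCast_ne_top k), one_mul]
      · simp
  · intro k' hk'
    rcases Nat.eq_zero_or_pos k' with rfl | hk
    · have hs : sizeBiased π hπ 0 = (0 : ℕ) * π 0 := rfl
      simp [hs]
    · rw [dif_pos hk.ne', PMF.map_apply]
      simp [hk'.symm]

/-- Splitting off the choice made at the root of the tree with a spine: the pair `(k, j)` has
probability `k π_k / k = π_k` for every `j < k`. -/
lemma lintegral_spineMeasure (π : PMF ℕ) (hπ : IsCritical π) {F : SpineData → ℝ≥0∞}
    (hF : Measurable F) :
    ∫⁻ ω, F ω ∂spineMeasure π hπ = ∑' k, π k * ∑ j ∈ Finset.range k,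
      ∫⁻ ω, F (ω.1, consSeq (k, j) ω.2) ∂spineMeasure π hπ := by
  set κ := (specialOffspring π hπ).toMeasure
  set σ := spineChoiceMeasure π hπ with hσ
  obtain ⟨hm, hmap⟩ := map_glue_infinitePi κ 0 Nat.succ Nat.succ_injective Nat.succ_ne_zero
    (by rintro (_ | n) <;> simp) (fun p => consSeq p.1 p.2) (fun _ => rfl) (fun _ _ => rfl)
  have hpres : MeasurePreserving (fun p : (ℕ × ℕ) × (ℕ → ℕ × ℕ) => consSeq p.1 p.2)
      (κ.prod σ) σ := ⟨hm, hmap⟩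
  have hcons : ∀ x, Measurable (consSeq x) := fun x =>
    hm.comp (measurable_const.prodMk measurable_id)
  have hFd : ∀ d, Measurable fun s => F (d, s) := fun d => hF.comp (by fun_prop)
  have hFx : ∀ x, Measurable fun ω : SpineData => F (ω.1, consSeq x ω.2) := fun x =>
    hF.comp (measurable_fst.prodMk ((hcons x).comp measurable_snd))
  rw [spineMeasure_eq, lintegral_prod _ hF.aemeasurable]
  have h1 : ∀ d, ∫⁻ s, F (d, s) ∂σ =
      ∑' x, specialOffspring π hπ x * ∫⁻ s, F (d, consSeq x s) ∂σ := by
    intro d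
    rw [← hpres.lintegral_comp (hFd d), lintegral_prod (fun p => F (d, consSeq p.1 p.2))
      ((hFd d).comp hm).aemeasurable, lintegral_pmf]
  refine (lintegral_congr h1).trans ?_
  rw [lintegral_tsum fun x => ((hFx x).lintegral_prod_right'.const_mul _).aemeasurable]
  have h2 : ∀ x, ∫⁻ d, specialOffspring π hπ x * ∫⁻ s, F (d, consSeq x s) ∂σ ∂treeMeasure π =
      specialOffspring π hπ x * ∫⁻ d, ∫⁻ s, F (d, consSeq x s) ∂σ ∂treeMeasure π :=
    fun x => lintegral_const_mul _ (hFx x).lintegral_prod_right'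
  refine (tsum_congr h2).trans ?_
  rw [ENNReal.tsum_prod']
  refine tsum_congr fun k => ?_
  rw [tsum_eq_sum (s := Finset.range k) (fun j hj => by
    rw [specialOffspring_apply, if_neg (by simpa using hj), zero_mul]), Finset.mul_sum]
  refine Finset.sum_congr rfl fun j hj => ?_
  rw [specialOffspring_apply, if_pos (Finset.mem_range.1 hj),
    lintegral_prod _ (hFx (k, j)).aemeasurable]

/-- The mean size of the cutset in the tree with a spine. -/
def spineMean (π : PMF ℕ) (hπ : IsCritical π) (m r L a : ℕ) : ℝ≥0∞ :=
  ∫⁻ ω, cutCount m r L a (spineOut ω) ∂spineMeasure π hπ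

lemma spineMean_le_one (π : PMF ℕ) (hπ : IsCritical π) {m r L a : ℕ} (h : L = 0 ∨ m ≤ a) :
    spineMean π hπ m r L a ≤ 1 := by
  have : ∀ ω, cutCount m r L a (spineOut ω) ≤ 1 := fun ω =>
    (cutCount_le_indicator h _).trans (Set.indicator_le_self' (by simp) _)
  refine (lintegral_mono this).trans ?_
  simp

lemma spineMean_succ (π : PMF ℕ) (hπ : IsCritical π) {m a : ℕ} (ha : a < m) (r L : ℕ) :
    spineMean π hπ m r (L + 1) a = ∑' k, π k * ∑ j ∈ Finset.range k,
      ((if 2 * m ≤ k then 1 else 0) + ∑ i ∈ Finset.range k,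
        if i = j then spineMean π hπ m r L (a + loopStep k i)
        else normalMean π m r L (a + loopStep k i)) := by
  rw [spineMean, lintegral_spineMeasure π hπ (F := fun ω => cutCount m r (L + 1) a (spineOut ω))
    ((measurable_cutCount m r (L + 1) a).comp measurable_spineOut)]
  refine tsum_congr fun k => ?_
  congr 1
  refine Finset.sum_congr rfl fun j _ => ?_
  have h1 : ∀ ω : SpineData, cutCount m r (L + 1) a (spineOut (ω.1, consSeq (k, j) ω.2)) =
      (if 2 * m ≤ k then 1 else 0) + ∑ i ∈ Finset.range k,
        if i = j then cutCount m r L (a + loopStep k i) (spineOut (subtreeAt ω.1 i, ω.2))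
        else cutCount m r L (a + loopStep k i) (subtreeAt ω.1 i) := by
    intro ω
    rw [cutCount_succ ha, spineOut_nil]
    congr 1
    refine Finset.sum_congr rfl fun i _ => ?_
    rw [subtreeAt_spineOut]
    split_ifs <;> rfl
  have hpres : ∀ i, MeasurePreserving (fun ω : SpineData => (subtreeAt ω.1 i, ω.2))
      (spineMeasure π hπ) (spineMeasure π hπ) := fun i => by
    rw [spineMeasure_eq]
    exact (measurePreserving_subtreeAt π i).prod (MeasurePreserving.id _)
  have hpres' : ∀ i, MeasurePreserving (fun ω : SpineData => subtreeAt ω.1 i)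
      (spineMeasure π hπ) (treeMeasure π) := fun i => by
    rw [spineMeasure_eq]
    exact (measurePreserving_subtreeAt π i).comp measurePreserving_fst
  have hms : ∀ b, Measurable fun ω => cutCount m r L b (spineOut ω) := fun b =>
    (measurable_cutCount m r L b).comp measurable_spineOut
  have hmi : ∀ i, Measurable fun ω : SpineData =>
      if i = j then cutCount m r L (a + loopStep k i) (spineOut (subtreeAt ω.1 i, ω.2))
        else cutCount m r L (a + loopStep k i) (subtreeAt ω.1 i) := by
    intro i
    by_cases h : i = j
    · simp only [h, if_true]
      exact (hms _).comp (hpres j).measurable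
    · simp only [h, if_false]
      exact (measurable_cutCount m r L _).comp (hpres' i).measurable
  simp only [h1]
  rw [lintegral_add_left measurable_const, lintegral_const, measure_univ, mul_one,
    lintegral_finsetSum _ fun i _ => hmi i]
  congr 1
  refine Finset.sum_congr rfl fun i _ => ?_
  split_ifs with h
  · exact (hpres i).lintegral_comp (hms _)
  · exact (hpres' i).lintegral_comp (measurable_cutCount m r L _)

/-- At most `4 m` vertices of a loop are at distance less than `2 m` from its starting point. -/
lemma card_filter_loopStep_le (k m a j : ℕ) (hj : j < k) :
    ((Finset.range k).filter fun i => i ≠ j ∧ a + loopStep k i < 2 * m).card ≤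
      min (k - 1) (4 * m) := by
  refine le_min ?_ ?_
  · calc _ ≤ ((Finset.range k).erase j).card := Finset.card_le_card fun i hi => by
          simp only [Finset.mem_filter, Finset.mem_erase] at hi ⊢; tauto
      _ = k - 1 := by rw [Finset.card_erase_of_mem (Finset.mem_range.2 hj), Finset.card_range]
  · calc _ ≤ (Finset.range (2 * m) ∪ Finset.Ico (k - 2 * m) k).card :=
          Finset.card_le_card fun i hi => by
            have hi := Finset.mem_filter.1 hi
            simp only [Finset.mem_range, Finset.mem_union, Finset.mem_Ico, loopStep] at hi ⊢
            omega
      _ ≤ 2 * m + (k - (k - 2 * m)) := by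
          refine (Finset.card_union_le _ _).trans ?_
          rw [Finset.card_range, Nat.card_Ico]
      _ ≤ 4 * m := by omega

/-- Each special vertex below depth `m` contributes to the cutset its own loop, if this is large,
and the cutsets of the normal trees attached to its loop at distance less than `2 m`. -/
lemma meanStep_mul_spineMean_le {π : PMF ℕ} (hπ : IsCritical π) {m : ℕ} (hm : 0 < m) (r : ℕ)
    (B : ℝ≥0∞) (hB : ∀ L a, normalMean π m r L a ≤ B) (L : ℕ) :
    meanStep π m * spineMean π hπ m r L 0 ≤ meanStep π m +
      (∑' k, π k * (k * ((if 2 * m ≤ k then 1 else 0) + B * ((min (k - 1) (4 * m) : ℕ) : ℝ≥0∞)))) *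
        ((2 * m : ℕ) : ℝ≥0∞) := by
  have h := meanStep_mul_le hπ m (spineMean π hπ m r) 1
    (∑' k, π k * (k * ((if 2 * m ≤ k then 1 else 0) + B * ((min (k - 1) (4 * m) : ℕ) : ℝ≥0∞))))
    (fun a => spineMean_le_one π hπ (Or.inl rfl)) (fun L a ha => spineMean_le_one π hπ (Or.inr ha))
    ?_ L 0
  · simpa using h
  intro L a ha
  rw [spineMean_succ π hπ ha, ← ENNReal.tsum_add]
  refine ENNReal.tsum_le_tsum fun k => ?_
  rw [← mul_add]
  gcongr
  have hk : (k : ℝ≥0∞) * ((if 2 * m ≤ k then 1 else 0) + B * ((min (k - 1) (4 * m) : ℕ) : ℝ≥0∞)) =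
      ∑ _j ∈ Finset.range k,
        ((if 2 * m ≤ k then 1 else 0) + B * ((min (k - 1) (4 * m) : ℕ) : ℝ≥0∞)) := by
    rw [Finset.sum_const, Finset.card_range, nsmul_eq_mul]
  rw [hk, ← Finset.sum_add_distrib]
  refine Finset.sum_le_sum fun j hj => ?_
  rw [add_assoc]
  gcongr
  have h1 : ∀ i ∈ Finset.range k, (if i = j then spineMean π hπ m r L (a + loopStep k i)
      else normalMean π m r L (a + loopStep k i)) ≤
      (if i ≠ j ∧ a + loopStep k i < 2 * m then B else 0) +
        (if i = j then spineMean π hπ m r L (a + loopStep k i) else 0) := by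
    intro i _
    by_cases hij : i = j
    · simp [hij]
    · by_cases hi : a + loopStep k i < 2 * m
      · simpa [hij, hi] using hB _ _
      · simp [hij, hi, normalMean_eq_zero π hm (not_lt.1 hi)]
  refine (Finset.sum_le_sum h1).trans ?_
  rw [Finset.sum_add_distrib, Finset.sum_ite_eq' _ j, if_pos hj, ← Finset.sum_filter,
    Finset.sum_const, nsmul_eq_mul, mul_comm]
  gcongr
  exact card_filter_loopStep_le k m a j (Finset.mem_range.1 hj)

/-- The mean size of the cutset stays bounded as the scale `m` varies. -/
lemma exists_spineMean_le {π : PMF ℕ} (hπ : IsCritical π) :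
    ∃ C : ℝ, 0 ≤ C ∧ ∀ m r L : ℕ, 0 < m → m ≤ r + 2 →
      spineMean π hπ m r L 0 ≤ ENNReal.ofReal C := by
  set S : ℕ → ℝ≥0∞ := fun m => ∑' k, π k * ((k * min (k - 1) (4 * m) : ℕ) : ℝ≥0∞) with hS
  have hS4 : ∀ m, S m ≤ 4 * meanChildren π m := by
    intro m
    rw [hS, meanChildren, ← ENNReal.tsum_mul_left]
    refine ENNReal.tsum_le_tsum fun k => ?_
    rw [mul_left_comm]
    gcongr
    have : k * min (k - 1) (4 * m) ≤ 4 * (k * min k m) := by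
      rw [mul_left_comm]
      exact Nat.mul_le_mul_left _ (by omega)
    exact_mod_cast this
  -- If `π 1 = 1`, nothing is attached to the spine, and the reach of a normal tree is irrelevant.
  have hpS : ∃ C₁ : ℝ, 0 ≤ C₁ ∧ ∀ m r : ℕ, 0 < m → m ≤ r + 2 →
      m * (reachProb π r * S m) ≤ ENNReal.ofReal C₁ * meanChildren π m := by
    by_cases h1 : π 1 = 1
    · refine ⟨0, le_rfl, fun m r _ _ => ?_⟩
      have hk : ∀ k ≠ 1, π k = 0 := by
        intro k hk
        have h := π.tsum_coe
        rw [tsum_eq_one_add_ite, h1] at h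
        have h0 := (ENNReal.add_right_inj ENNReal.one_ne_top).1 (h.trans (add_zero 1).symm)
        simpa [hk] using ENNReal.tsum_eq_zero.1 h0 k
      have : S m = 0 := by
        refine ENNReal.tsum_eq_zero.2 fun k => ?_
        by_cases hk1 : k = 1
        · simp [hk1]
        · simp [hk k hk1]
      simp [this]
    · obtain ⟨A, hA, hp⟩ := exists_reachProb_le π hπ h1
      refine ⟨4 * (2 + 3 * A), by positivity, fun m r hm hmr => ?_⟩
      have hmp : m * reachProb π r ≤ ENNReal.ofReal (2 + 3 * A) := by
        by_cases hm2 : m ≤ 2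
        · calc (m : ℝ≥0∞) * reachProb π r ≤ 2 * 1 := by
                gcongr
                · exact_mod_cast hm2
                · exact reachProb_le_one π r
            _ = ENNReal.ofReal 2 := by simp
            _ ≤ _ := ENNReal.ofReal_le_ofReal (by linarith)
        · have hr : 0 < r := by omega
          have hr0 : (0 : ℝ) < r := by exact_mod_cast hr
          have hmr' : (m : ℝ) ≤ 3 * r := by exact_mod_cast (by omega : m ≤ 3 * r)
          calc (m : ℝ≥0∞) * reachProb π r ≤ m * ENNReal.ofReal (A / r) := by gcongr; exact hp r hr
            _ = ENNReal.ofReal (m * (A / r)) := by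
                rw [ENNReal.ofReal_mul (by positivity), ENNReal.ofReal_natCast]
            _ ≤ _ := by
                refine ENNReal.ofReal_le_ofReal ?_
                rw [← mul_div_assoc, div_le_iff₀ hr0]
                nlinarith
      calc (m : ℝ≥0∞) * (reachProb π r * S m) = m * reachProb π r * S m := (mul_assoc _ _ _).symm
        _ ≤ ENNReal.ofReal (2 + 3 * A) * (4 * meanChildren π m) := by gcongr; exact hS4 m
        _ = _ := by
          rw [ENNReal.ofReal_mul (by norm_num), ENNReal.ofReal_ofNat]
          ring
  obtain ⟨C₁, hC₁, hpS⟩ := hpS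
  refine ⟨1 + 6 * (98 + 2 * C₁), by positivity, fun m r L hm hmr => ?_⟩
  set M := meanStep π m with hM
  set Q := meanChildren π m with hQ
  have hM0 : M ≠ 0 := meanStep_ne_zero hπ hm
  have hMt : M ≠ ∞ := meanStep_ne_top hπ m
  have hQM : Q ≤ 6 * M := meanChildren_le π m
  have hm0 : (m : ℝ≥0∞) ≠ 0 := by simpa using hm.ne'
  have hmt : (m : ℝ≥0∞) ≠ ∞ := ENNReal.natCast_ne_top m
  have hb : (m : ℝ≥0∞) * (m * offspringTail π (2 * m)) ≤ Q := by
    rw [offspringTail, hQ, meanChildren, ← ENNReal.tsum_mul_left, ← ENNReal.tsum_mul_left]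
    refine ENNReal.tsum_le_tsum fun k => ?_
    split_ifs with hk
    · rw [mul_one, ← mul_assoc, mul_comm]
      gcongr
      have : m * m ≤ k * min k m := Nat.mul_le_mul (by omega) (by omega)
      exact_mod_cast this
    · simp
  have hB : (m : ℝ≥0∞) * ∑' k, π k * (k * if 2 * m ≤ k then 1 else 0) ≤ Q := by
    rw [hQ, meanChildren, ← ENNReal.tsum_mul_left]
    refine ENNReal.tsum_le_tsum fun k => ?_
    split_ifs with hk
    · rw [mul_left_comm, mul_one]
      gcongr
      have : m * k ≤ k * min k m := by
        rw [mul_comm]; exact Nat.mul_le_mul_left _ (by omega)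
      exact_mod_cast this
    · simp
  have hN : ∀ L a, normalMean π m r L a ≤ reachProb π r + 12 / m := by
    intro L a
    have h := meanStep_mul_normalMean_le hπ m r L a
    rw [← ENNReal.mul_le_mul_iff_right hM0 hMt, mul_add]
    refine h.trans (add_le_add le_rfl ?_)
    rw [← mul_div_assoc, ENNReal.le_div_iff_mul_le (Or.inl hm0) (Or.inl hmt)]
    calc offspringTail π (2 * m) * ((2 * m : ℕ) : ℝ≥0∞) * m
        = 2 * (m * (m * offspringTail π (2 * m))) := by push_cast; ring
      _ ≤ 2 * (6 * M) := mul_le_mul_right (hb.trans hQM) 2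
      _ = M * 12 := by ring
  have hT := meanStep_mul_spineMean_le hπ hm r _ hN L
  have hK : (∑' k, π k * (k * ((if 2 * m ≤ k then 1 else 0) +
      (reachProb π r + 12 / m) * ((min (k - 1) (4 * m) : ℕ) : ℝ≥0∞)))) =
      (∑' k, π k * (k * if 2 * m ≤ k then 1 else 0)) + (reachProb π r + 12 / m) * S m := by
    rw [hS, ← ENNReal.tsum_mul_left, ← ENNReal.tsum_add]
    refine tsum_congr fun k => ?_
    push_cast
    ring
  rw [hK] at hT
  rw [← ENNReal.mul_le_mul_iff_right hM0 hMt]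
  refine hT.trans ?_
  have h12 : (m : ℝ≥0∞) * (12 / m) = 12 := ENNReal.mul_div_cancel hm0 hmt
  calc M + ((∑' k, π k * (k * if 2 * m ≤ k then 1 else 0)) +
        (reachProb π r + 12 / m) * S m) * ((2 * m : ℕ) : ℝ≥0∞)
      = M + (2 * (m * ∑' k, π k * (k * if 2 * m ≤ k then 1 else 0)) +
        2 * (m * (reachProb π r * S m)) + 2 * (m * (12 / m)) * S m) := by push_cast; ring
    _ ≤ M + (2 * Q + 2 * (ENNReal.ofReal C₁ * Q) + 2 * 12 * (4 * Q)) := by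
        rw [h12]
        have h4 := hpS m r hm hmr
        have h5 := hS4 m
        refine add_le_add le_rfl (add_le_add (add_le_add ?_ ?_) ?_)
        · exact mul_le_mul_right hB 2
        · exact mul_le_mul_right h4 2
        · exact mul_le_mul_right h5 _
    _ = M + (98 + 2 * ENNReal.ofReal C₁) * Q := by ring
    _ ≤ M + (98 + 2 * ENNReal.ofReal C₁) * (6 * M) := by gcongr
    _ = M * (1 + 6 * (98 + 2 * ENNReal.ofReal C₁)) := by ring
    _ = M * ENNReal.ofReal (1 + 6 * (98 + 2 * C₁)) := by
        rw [ENNReal.ofReal_add (by norm_num) (by positivity), ENNReal.ofReal_mul (by norm_num),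
          ENNReal.ofReal_add (by norm_num) (by positivity), ENNReal.ofReal_mul (by norm_num)]
        simp

end

theorem mainTheorem6 (π : PMF ℕ) (hπ : IsCritical π) (α : ℝ) (hα : 1 < α) (hα' : α ≤ 2)
    (hstable : InStableDomain π α) (q : ℝ) (hq : 0 < q) (hq' : q < α - 1) :
    ∃ c : ℝ, 0 < c ∧ ∀ n : ℕ, 1 ≤ n → ∀ t : ℝ, 0 < t →
      spineMeasure π hπ
          {ω | effectiveResistance (randomLooptree ω) {looptreeRoot ω}
              (graphBall (randomLooptree ω) (looptreeRoot ω) n)ᶜ < ENNReal.ofReal (t⁻¹ * n)} ≤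
        ENNReal.ofReal (c * t ^ (-q)) := by
  obtain ⟨C, hC0, hC⟩ := exists_spineMean_le hπ
  refine ⟨6 * C + 1, by positivity, fun n hn t ht => ?_⟩
  by_cases ht1 : t < 1
  · refine prob_le_one.trans ?_
    rw [← ENNReal.ofReal_one]
    refine ENNReal.ofReal_le_ofReal ?_
    have : 1 ≤ t ^ (-q) := Real.one_le_rpow_of_pos_of_le_one_of_nonpos ht ht1.le (by linarith)
    nlinarith
  push Not at ht1
  -- `m = ⌈n / 3⌉`, so that `m ≤ n` and a depth of about `m` remains between `2 m` and `n`.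
  set m := (n + 2) / 3 with hm
  have hm0 : 0 < m := by omega
  have hmR : (0 : ℝ) < m := by exact_mod_cast hm0
  have hnR : (0 : ℝ) < n := by exact_mod_cast hn
  have hnm : (n : ℝ) ≤ 3 * m := by exact_mod_cast (by omega : n ≤ 3 * m)
  have hsub : {ω | effectiveResistance (randomLooptree ω) {looptreeRoot ω}
      (graphBall (randomLooptree ω) (looptreeRoot ω) n)ᶜ < ENNReal.ofReal (t⁻¹ * n)} ⊆
      {ω | ENNReal.ofReal (t / 6) ≤ cutCount m (n - 2 * m) m 0 (spineOut ω)} := by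
    intro ω hω
    have h1 := (inv_le_effectiveResistance (spineOut ω) hm0 (by omega : m ≤ n)).trans_lt hω
    have h2 := ENNReal.inv_lt_iff_inv_lt.1 h1
    rw [← ENNReal.ofReal_inv_of_pos (by positivity)] at h2
    by_contra hlt
    rw [Set.mem_ofPred_eq, not_le] at hlt
    refine absurd h2 (not_lt.2 ?_)
    calc cutCount m (n - 2 * m) m 0 (spineOut ω) * ENNReal.ofReal (2 / m)
        ≤ ENNReal.ofReal (t / 6) * ENNReal.ofReal (2 / m) := by gcongr
      _ = ENNReal.ofReal (t / 6 * (2 / m)) := (ENNReal.ofReal_mul (by positivity)).symm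
      _ ≤ _ := by
        refine ENNReal.ofReal_le_ofReal ?_
        rw [mul_inv, inv_inv, ← div_eq_mul_inv, div_mul_div_comm,
          div_le_div_iff₀ (by positivity) hnR]
        nlinarith
  have hmarkov := mul_meas_ge_le_lintegral (μ := spineMeasure π hπ)
    ((measurable_cutCount m (n - 2 * m) m 0).comp measurable_spineOut) (ENNReal.ofReal (t / 6))
  refine (measure_mono hsub).trans ?_
  have ht6 : ENNReal.ofReal (t / 6) ≠ 0 := by simpa using ht
  calc spineMeasure π hπ {ω | ENNReal.ofReal (t / 6) ≤ cutCount m (n - 2 * m) m 0 (spineOut ω)}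
      ≤ ENNReal.ofReal C / ENNReal.ofReal (t / 6) := by
        rw [ENNReal.le_div_iff_mul_le (Or.inl ht6) (Or.inl ENNReal.ofReal_ne_top), mul_comm]
        exact hmarkov.trans (hC m (n - 2 * m) m hm0 (by omega))
    _ = ENNReal.ofReal (C / (t / 6)) := (ENNReal.ofReal_div_of_pos (by positivity)).symm
    _ ≤ _ := by
        refine ENNReal.ofReal_le_ofReal ?_
        -- The first moment bound gives `q = 1`, which is more than needed as `α ≤ 2`.
        have h1 : t⁻¹ ≤ t ^ (-q) := by
          rw [← Real.rpow_neg_one]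
          exact Real.rpow_le_rpow_of_exponent_le ht1 (by linarith)
        have h2 : C / (t / 6) = 6 * C * t⁻¹ := by field_simp
        rw [h2]
        have h3 : 0 < t ^ (-q) := by positivity
        nlinarith
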